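/- \textbf{Future long-time existence.} Let $R_0>0$ and let $R_b(t,x)=R_0e^{2t}\cosh(2x)$ on $\mathbb{R}\times\mathbb{R}$. Consider the system \begin{align*} &R_{xx}-R_{tt}=0,\\ &W_{tt}-W_{xx}+\frac{R_t}{R}W_t-\frac{R_x}{R}W_x+\frac{q_t^2-q_x^2}{2}e^{-4W}=0,\\ &q_{tt}-q_{xx}+\frac{R_t}{R}q_t-\frac{R_x}{R}q_x-4q_tW_t+4q_xW_x=0 \end{align*} for real functions $R,W,q$ of $(t,x)$, $t\ge 0$, $x\in\mathbb{R}$. Let initial data $R(0,\cdot),W(0,\cdot),q(0,\cdot)\in C^2(\mathbb{R})$ and $R_t(0,\cdot),W_t(0,\cdot),q_t(0,\cdot)\in C^1(\mathbb{R})$ be given such that $$m_0(0):=\sup_{x\in\mathbb{R}}|R(0,x)-R_b(0,x)|+\sup_{x\in\mathbb{R}}|R_t(0,x)-(R_b)_t(0,x)|<\frac{2R_0}{3}.$$ Then there is a unique $C^2$ solution $(R,W,q)$ of the system, defined on all of $[0,\infty)\times\mathbb{R}$, with these initial data; it satisfies $R>0$ for all $t\ge 0$. -/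

import Mathlib

open Set
open scoped ENNReal

noncomputable section

namespace DoubleCusp

/-- The closed future half-plane `{(t, x) : t ≥ 0}`. -/
def future : Set (ℝ × ℝ) := Ici 0 ×ˢ univ

/-- Time derivative `f_t (t, x)` of a function on `t ≥ 0` (one-sided at `t = 0`). -/
def dt (f : ℝ → ℝ → ℝ) (t x : ℝ) : ℝ := derivWithin (fun s => f s x) (Ici 0) t

/-- Space derivative `f_x (t, x)`. -/
def dx (f : ℝ → ℝ → ℝ) (t x : ℝ) : ℝ := deriv (fun y => f t y) x

/-- The area function of the double cusp, `R_b (t, x) = R₀ e^{2t} cosh (2x)`. -/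
def Rb (R₀ t x : ℝ) : ℝ := R₀ * Real.exp (2 * t) * Real.cosh (2 * x)

/-- `m₀` at time `t`, for a function with time slice `r = R (t, ·)` and velocity
`r' = R_t (t, ·)`: `‖r - R_b (t, ·)‖_{C⁰} + ‖r' - ∂_t R_b (t, ·)‖_{C⁰}`. The sup norms over the
real line take values in `[0, ∞]`. -/
def m₀ (R₀ t : ℝ) (r r' : ℝ → ℝ) : ℝ≥0∞ :=
  (⨆ x, ‖r x - Rb R₀ t x‖ₑ) + ⨆ x, ‖r' x - deriv (fun s => Rb R₀ s x) t‖ₑ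

/-- `(R, W, q)` is a `C²` solution, on all of `t ≥ 0`, of the wave equation for `R` coupled to the
wave map equations for `(W, q)`. Values at negative times play no role. -/
structure IsSolution (R W q : ℝ → ℝ → ℝ) : Prop where
  contDiffOn_R : ContDiffOn ℝ 2 (fun p : ℝ × ℝ => R p.1 p.2) future
  contDiffOn_W : ContDiffOn ℝ 2 (fun p : ℝ × ℝ => W p.1 p.2) future
  contDiffOn_q : ContDiffOn ℝ 2 (fun p : ℝ × ℝ => q p.1 p.2) future
  eq_R : ∀ t, 0 ≤ t → ∀ x, dx (dx R) t x - dt (dt R) t x = 0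
  eq_W : ∀ t, 0 ≤ t → ∀ x,
    dt (dt W) t x - dx (dx W) t x
      + dt R t x / R t x * dt W t x - dx R t x / R t x * dx W t x
      + (dt q t x ^ 2 - dx q t x ^ 2) / 2 * Real.exp (-4 * W t x) = 0
  eq_q : ∀ t, 0 ≤ t → ∀ x,
    dt (dt q) t x - dx (dx q) t x
      + dt R t x / R t x * dt q t x - dx R t x / R t x * dx q t x
      - 4 * dt q t x * dt W t x + 4 * dx q t x * dx W t x = 0

/-- `f` attains the initial value `f₀` and the initial velocity `f₁` at `t = 0`. -/
def HasData (f : ℝ → ℝ → ℝ) (f₀ f₁ : ℝ → ℝ) : Prop :=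
  ∀ x, f 0 x = f₀ x ∧ dt f 0 x = f₁ x

end DoubleCusp

end

/-! In the null coordinates `u = t - x`, `v = t + x` the equation for `R` is `R_uv = 0`, solved by
d'Alembert's formula. The background contributes `R₀ (exp (2u) + exp (2v)) / 2`, which for `u + v ≥
0` outgrows the perturbation permitted by the smallness hypothesis, so `R` stays positive
(`dAlembert_pos`) and the coefficients of the other two equations stay regular.

Those two equations are a wave map, damped by `R`, into the hyperbolic plane with metric `dW² + exp
(-4W) dq² / 4`. Write the null derivatives in an orthonormal frame, weighted by `√R`: `P = √R (W_v +
i exp (-2W) q_v / 2)` and `M = √R (W_u + i exp (-2W) q_u / 2)`. The equations become `P_u = α M + i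
κ (Im M) P` and `M_v = β P + i κ (Im P) M` with real `α, β, κ` depending only on `R`. The system no
longer contains `W` and `q`, and its quadratic terms are infinitesimal rotations, which do not
change norms (`norm_le_of_rotation`). Hence `P` and `M` obey the a priori bounds of a linear system,
and Picard iteration converges on every bounded square (`picard_estimates`, `exists_frame`). The
compatibility `P`-`M` makes the frame components closed one-forms, from which `W` and then `q` are
integrated (`exists_potential`, `exists_null_solution`).

For uniqueness, the difference of two solutions satisfies a transport system along characteristics
with zero data and a Lipschitz right-hand side on compact triangles. An exponentially weighted
estimate forces it to vanish (`eq_zero_of_transport_system`), first for `R`, then for `(W, q)`. -/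

namespace DoubleCusp

open Set Filter Topology MeasureTheory
open scoped ENNReal Manifold ContDiff

/-! ### Partial derivatives and integrals along characteristics -/

section Calculus

variable {E : Type*} [NormedAddCommGroup E] [NormedSpace ℝ E]

theorem hasFDerivAt_of_partials {F Fu Fv : ℝ → ℝ → E}
    (hu : ∀ u v, HasDerivAt (fun s => F s v) (Fu u v) u)
    (hv : ∀ u v, HasDerivAt (fun s => F u s) (Fv u v) v)
    (cu : Continuous fun p : ℝ × ℝ => Fu p.1 p.2)
    (cv : Continuous fun p : ℝ × ℝ => Fv p.1 p.2) (p : ℝ × ℝ) :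
    HasFDerivAt (fun p : ℝ × ℝ => F p.1 p.2)
      ((ContinuousLinearMap.fst ℝ ℝ ℝ).smulRight (Fu p.1 p.2)
        + (ContinuousLinearMap.snd ℝ ℝ ℝ).smulRight (Fv p.1 p.2)) p := by
  have h := (hasStrictFDerivAt_uncurry_coprod (𝕜 := ℝ) (u := p) (f := F)
    (f₁ := fun u v => (1 : ℝ →L[ℝ] ℝ).smulRight (Fu u v))
    (f₂ := fun u v => (1 : ℝ →L[ℝ] ℝ).smulRight (Fv u v))
    (Eventually.of_forall fun w => (hu w.1 w.2).hasFDerivAt)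
    (Eventually.of_forall fun w => (hv w.1 w.2).hasFDerivAt)
    (by
      refine Continuous.continuousAt ?_
      exact (ContinuousLinearMap.smulRightL ℝ ℝ E 1).continuous.comp cu)
    (by
      refine Continuous.continuousAt ?_
      exact (ContinuousLinearMap.smulRightL ℝ ℝ E 1).continuous.comp cv)).hasFDerivAt
  refine h.congr_fderiv (ContinuousLinearMap.ext fun x => ?_)
  simp [Function.HasUncurry.uncurry]

theorem contDiff_succ_of_partials {F Fu Fv : ℝ → ℝ → E} {n : ℕ}
    (hu : ∀ u v, HasDerivAt (fun s => F s v) (Fu u v) u)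
    (hv : ∀ u v, HasDerivAt (fun s => F u s) (Fv u v) v)
    (cu : ContDiff ℝ n fun p : ℝ × ℝ => Fu p.1 p.2)
    (cv : ContDiff ℝ n fun p : ℝ × ℝ => Fv p.1 p.2) :
    ContDiff ℝ (n + 1) fun p : ℝ × ℝ => F p.1 p.2 := by
  have h := hasFDerivAt_of_partials hu hv cu.continuous cv.continuous
  refine contDiff_succ_iff_fderiv.2 ⟨fun p => (h p).differentiableAt, by simp, ?_⟩
  rw [funext fun p => (h p).fderiv]
  exact (contDiff_const.smulRight cu).add (contDiff_const.smulRight cv)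

/-- The partial derivatives of a `C¹` function of two variables. -/
theorem exists_partials {F : ℝ → ℝ → E} {n : ℕ}
    (h : ContDiff ℝ (n + 1) fun p : ℝ × ℝ => F p.1 p.2) :
    ∃ Fu Fv : ℝ → ℝ → E,
      (∀ u v, HasDerivAt (fun s => F s v) (Fu u v) u) ∧
      (∀ u v, HasDerivAt (fun s => F u s) (Fv u v) v) ∧
      (ContDiff ℝ n fun p : ℝ × ℝ => Fu p.1 p.2) ∧
      (ContDiff ℝ n fun p : ℝ × ℝ => Fv p.1 p.2) := by
  have hd : ∀ p : ℝ × ℝ, HasFDerivAt (fun p : ℝ × ℝ => F p.1 p.2)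
      (fderiv ℝ (fun p : ℝ × ℝ => F p.1 p.2) p) p :=
    fun p => (h.differentiable (by simp) p).hasFDerivAt
  have hc := (contDiff_succ_iff_fderiv.1 h).2.2
  refine ⟨fun u v => fderiv ℝ (fun p : ℝ × ℝ => F p.1 p.2) (u, v) (1, 0),
    fun u v => fderiv ℝ (fun p : ℝ × ℝ => F p.1 p.2) (u, v) (0, 1), fun u v => ?_, fun u v => ?_,
    hc.clm_apply contDiff_const, hc.clm_apply contDiff_const⟩
  · exact (hd (u, v)).comp_hasDerivAt u ((hasDerivAt_id u).prodMk (hasDerivAt_const u v))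
  · exact (hd (u, v)).comp_hasDerivAt v ((hasDerivAt_const v u).prodMk (hasDerivAt_id v))

theorem continuous_integral_param {g : ℝ → ℝ → E} (hg : Continuous fun p : ℝ × ℝ => g p.1 p.2) :
    Continuous fun p : ℝ × ℝ => ∫ s in (0 : ℝ)..p.1, g s p.2 := by
  refine intervalIntegral.continuous_parametric_intervalIntegral_of_continuous
    (f := fun (p : ℝ × ℝ) s => g s p.2) ?_ continuous_fst
  exact hg.comp (continuous_snd.prodMk (continuous_snd.comp continuous_fst))

theorem hasDerivAt_integral_param {g gv : ℝ → ℝ → E} (hg : Continuous fun p : ℝ × ℝ => g p.1 p.2)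
    (hgv : Continuous fun p : ℝ × ℝ => gv p.1 p.2)
    (hd : ∀ s v, HasDerivAt (fun y => g s y) (gv s v) v) (a b v : ℝ) :
    HasDerivAt (fun y => ∫ s in a..b, g s y) (∫ s in a..b, gv s v) v := by
  obtain ⟨C, hC⟩ := (isCompact_uIcc (a := a) (b := b)).prod (isCompact_closedBall v 1)
    |>.exists_bound_of_continuousOn hgv.continuousOn
  have c1 : ∀ y, Continuous fun s => g s y := fun y => hg.comp (Continuous.prodMk_left y)
  have c2 : ∀ y, Continuous fun s => gv s y := fun y => hgv.comp (Continuous.prodMk_left y)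
  refine (intervalIntegral.hasDerivAt_integral_of_dominated_loc_of_deriv_le
    (bound := fun _ => C) (F' := fun y s => gv s y)
    (Metric.ball_mem_nhds v one_pos) (Eventually.of_forall fun y => (c1 y).aestronglyMeasurable)
    ((c1 v).intervalIntegrable _ _) (c2 v).aestronglyMeasurable ?_ (by simp) ?_).2
  · refine Eventually.of_forall fun s hs y hy => hC (s, y) ⟨?_, ?_⟩
    · exact uIoc_subset_uIcc hs
    · exact Metric.ball_subset_closedBall hy
  · exact Eventually.of_forall fun s _ y _ => hd s y

/-- Integration supplies the derivative in the first variable, which is the integrand itself, so the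
integrand need be differentiable only in the second. This is what later upgrades continuous
solutions of the transport equations to `C¹`. -/
theorem contDiff_integral_param [CompleteSpace E] {g gv : ℝ → ℝ → E} (hg : Continuous fun p : ℝ × ℝ => g p.1 p.2)
    (hgv : Continuous fun p : ℝ × ℝ => gv p.1 p.2)
    (hd : ∀ s v, HasDerivAt (fun y => g s y) (gv s v) v) :
    ContDiff ℝ 1 fun p : ℝ × ℝ => ∫ s in (0 : ℝ)..p.1, g s p.2 := by
  refine contDiff_succ_of_partials (n := 0) (F := fun u v => ∫ s in (0 : ℝ)..u, g s v)
    (Fu := g) (Fv := fun u v => ∫ s in (0 : ℝ)..u, gv s v) (fun u v => ?_) (fun u v => ?_)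
    (contDiff_zero.2 hg) (contDiff_zero.2 (continuous_integral_param hgv))
  · have c1 : Continuous fun s => g s v := hg.comp (Continuous.prodMk_left v)
    exact intervalIntegral.integral_hasDerivAt_right (c1.intervalIntegrable _ _)
      c1.aestronglyMeasurable.stronglyMeasurableAtFilter c1.continuousAt
  · exact hasDerivAt_integral_param hg hgv hd 0 u v

theorem integral_eq_integral_zero_sub {g : ℝ → ℝ → E}
    (hg : Continuous fun p : ℝ × ℝ => g p.1 p.2) (u v : ℝ) :
    ∫ s in -v..u, g s v = (∫ s in (0 : ℝ)..u, g s v) - ∫ s in (0 : ℝ)..-v, g s v := by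
  have c1 : Continuous fun s => g s v := hg.comp (Continuous.prodMk_left v)
  exact (intervalIntegral.integral_interval_sub_left (c1.intervalIntegrable _ _)
    (c1.intervalIntegrable _ _)).symm

theorem continuous_integral_line {g : ℝ → ℝ → E} (hg : Continuous fun p : ℝ × ℝ => g p.1 p.2) :
    Continuous fun p : ℝ × ℝ => ∫ s in -p.2..p.1, g s p.2 := by
  simp_rw [integral_eq_integral_zero_sub hg]
  exact (continuous_integral_param hg).sub
    ((continuous_integral_param hg).comp (continuous_snd.neg.prodMk continuous_snd))

theorem contDiff_integral_line [CompleteSpace E] {g gv : ℝ → ℝ → E} (hg : Continuous fun p : ℝ × ℝ => g p.1 p.2)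
    (hgv : Continuous fun p : ℝ × ℝ => gv p.1 p.2)
    (hd : ∀ s v, HasDerivAt (fun y => g s y) (gv s v) v) :
    ContDiff ℝ 1 fun p : ℝ × ℝ => ∫ s in -p.2..p.1, g s p.2 := by
  simp_rw [integral_eq_integral_zero_sub hg]
  have h := contDiff_integral_param hg hgv hd
  exact h.sub (h.comp (contDiff_snd.neg.prodMk contDiff_snd))

theorem hasDerivAt_integral_line_left [CompleteSpace E] {g : ℝ → ℝ → E}
    (hg : Continuous fun p : ℝ × ℝ => g p.1 p.2) (u v : ℝ) :
    HasDerivAt (fun y => ∫ s in -v..y, g s v) (g u v) u := by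
  have c1 : Continuous fun s => g s v := hg.comp (Continuous.prodMk_left v)
  exact intervalIntegral.integral_hasDerivAt_right (c1.intervalIntegrable _ _)
      c1.aestronglyMeasurable.stronglyMeasurableAtFilter c1.continuousAt

theorem hasDerivAt_integral_line_right [CompleteSpace E] {g gv : ℝ → ℝ → E}
    (hg : Continuous fun p : ℝ × ℝ => g p.1 p.2)
    (hgv : Continuous fun p : ℝ × ℝ => gv p.1 p.2)
    (hd : ∀ s v, HasDerivAt (fun y => g s y) (gv s v) v) (u v : ℝ) :
    HasDerivAt (fun y => ∫ s in -y..u, g s y) ((∫ s in -v..u, gv s v) + g (-v) v) v := by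
  have c1 : Continuous fun s => g s v := hg.comp (Continuous.prodMk_left v)
  have h := ((contDiff_integral_param hg hgv hd).differentiable (by simp) (-v, v)).hasFDerivAt
  have e1 : fderiv ℝ (fun p : ℝ × ℝ => ∫ s in (0 : ℝ)..p.1, g s p.2) (-v, v) (1, 0) = g (-v) v :=
    (h.comp_hasDerivAt (f := fun y => ((y, v) : ℝ × ℝ)) (-v) ((hasDerivAt_id (-v)).prodMk (hasDerivAt_const (-v) v))).unique
      (intervalIntegral.integral_hasDerivAt_right (c1.intervalIntegrable _ _)
      c1.aestronglyMeasurable.stronglyMeasurableAtFilter c1.continuousAt)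
  have e2 : fderiv ℝ (fun p : ℝ × ℝ => ∫ s in (0 : ℝ)..p.1, g s p.2) (-v, v) (0, 1)
      = ∫ s in (0 : ℝ)..-v, gv s v :=
    (h.comp_hasDerivAt (f := fun y => ((-v, y) : ℝ × ℝ)) v ((hasDerivAt_const v (-v)).prodMk (hasDerivAt_id v))).unique
      (hasDerivAt_integral_param hg hgv hd 0 (-v) v)
  have h2 := h.comp_hasDerivAt (f := fun y => ((-y, y) : ℝ × ℝ)) v ((hasDerivAt_neg v).prodMk (hasDerivAt_id v))
  have h3 := (hasDerivAt_integral_param hg hgv hd 0 u v).sub h2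
  simp_rw [integral_eq_integral_zero_sub hg, integral_eq_integral_zero_sub hgv]
  refine h3.congr_deriv ?_
  have : ((-1, 1) : ℝ × ℝ) = (-1 : ℝ) • (1, 0) + (0, 1) := by simp
  rw [this, map_add, map_smul, e1, e2]
  simp only [neg_smul, one_smul]
  abel

end Calculus

/-! ### The transport equation with a rotation term -/

section Transport

open Complex (I)

/-- Integrating the weight `exp (μ |s - a|)` away from `a` reproduces it with a gain of `1 / μ`.
Choosing `μ` large makes integral operators small without shrinking the domain. -/
theorem abs_integral_norm_le_exp {E : Type*} [NormedAddCommGroup E] {f : ℝ → E}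
    (hf : Continuous f) {C μ a b : ℝ} (hC : 0 ≤ C) (hμ : 0 < μ)
    (h : ∀ s ∈ uIcc a b, ‖f s‖ ≤ C * Real.exp (μ * |s - a|)) :
    |∫ s in a..b, ‖f s‖| ≤ C / μ * Real.exp (μ * |b - a|) := by
  -- The sign `ε = ±1` resolves `|s - a|` according to the side of `a` on which `b` lies.
  have hder : ∀ ε : ℝ, ε ≠ 0 → ∀ x y : ℝ, ∫ s in x..y, C * Real.exp (μ * (ε * (s - a)))
      = C / (μ * ε) * Real.exp (μ * (ε * (y - a))) - C / (μ * ε) * Real.exp (μ * (ε * (x - a))) := by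
    intro ε hε x y
    refine intervalIntegral.integral_eq_sub_of_hasDerivAt
      (f := fun s => C / (μ * ε) * Real.exp (μ * (ε * (s - a)))) (fun s _ => ?_)
      ((by fun_prop : Continuous fun s => C * Real.exp (μ * (ε * (s - a)))).intervalIntegrable _ _)
    have := ((((hasDerivAt_id s).sub_const a).const_mul ε).const_mul μ).exp.const_mul (C / (μ * ε))
    refine this.congr_deriv ?_
    simp only [id]
    field_simp
  rcases le_total a b with hab | hab
  · rw [abs_of_nonneg (intervalIntegral.integral_nonneg hab fun _ _ => norm_nonneg _),
      abs_of_nonneg (sub_nonneg.2 hab)]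
    calc ∫ s in a..b, ‖f s‖ ≤ ∫ s in a..b, C * Real.exp (μ * (1 * (s - a))) := by
          refine intervalIntegral.integral_mono_on hab (hf.norm.intervalIntegrable _ _)
            (Continuous.intervalIntegrable (by fun_prop) _ _) fun s hs => ?_
          have := h s (by rwa [uIcc_of_le hab])
          rwa [abs_of_nonneg (sub_nonneg.2 hs.1), ← one_mul (s - a)] at this
      _ ≤ _ := by
          rw [hder 1 one_ne_zero]
          simp only [mul_one, one_mul]
          have : 0 ≤ C / μ * Real.exp (μ * (a - a)) := by positivity
          linarith
  · rw [intervalIntegral.integral_symm, abs_neg,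
      abs_of_nonneg (intervalIntegral.integral_nonneg hab fun _ _ => norm_nonneg _),
      abs_of_nonpos (sub_nonpos.2 hab)]
    calc ∫ s in b..a, ‖f s‖ ≤ ∫ s in b..a, C * Real.exp (μ * (-1 * (s - a))) := by
          refine intervalIntegral.integral_mono_on hab (hf.norm.intervalIntegrable _ _)
            (Continuous.intervalIntegrable (by fun_prop) _ _) fun s hs => ?_
          have := h s (by rwa [uIcc_of_ge hab])
          rwa [abs_of_nonpos (sub_nonpos.2 hs.2), ← neg_one_mul] at this
      _ ≤ _ := by
          rw [hder (-1) (by norm_num), neg_one_mul (b - a)]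
          have : 0 ≤ C / μ * Real.exp (μ * (-1 * (a - a))) := by positivity
          rw [show C / (μ * -1) = -(C / μ) by rw [mul_neg_one, div_neg]]
          linarith

/-- The rotation term `I θ y` does not contribute to the growth of a solution of
`y' = f + I θ y`. -/
theorem norm_le_of_rotation {y f : ℝ → ℂ} {θ : ℝ → ℝ} (hf : Continuous f) (hθ : Continuous θ)
    (hy : ∀ s, HasDerivAt y (f s + I * θ s * y s) s) (a b : ℝ) :
    ‖y b‖ ≤ ‖y a‖ + |∫ s in a..b, ‖f s‖| := by
  -- The integrating factor `exp (-I Θ)` has modulus one and removes the rotation term, leaving only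
  -- `f` to be integrated.
  set Θ : ℝ → ℝ := fun s => ∫ r in a..s, θ r with hΘ
  have hΘd : ∀ s, HasDerivAt Θ (θ s) s := fun s =>
    intervalIntegral.integral_hasDerivAt_right (hθ.intervalIntegrable _ _)
      hθ.aestronglyMeasurable.stronglyMeasurableAtFilter hθ.continuousAt
  have hΘc : Continuous Θ := continuous_iff_continuousAt.2 fun s => (hΘd s).continuousAt
  have hn : ∀ s, ‖Complex.exp (-(I * Θ s))‖ = 1 := fun s => by
    rw [Complex.norm_exp]; simp
  have hd : ∀ s, HasDerivAt (fun s => Complex.exp (-(I * Θ s)) * y s)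
      (Complex.exp (-(I * Θ s)) * f s) s := fun s => by
    have h1 : HasDerivAt (fun s => Complex.exp (-(I * (Θ s : ℂ))))
        (Complex.exp (-(I * (Θ s : ℂ))) * (-(I * (θ s : ℂ)))) s :=
      ((hΘd s).ofReal_comp.const_mul I).neg.cexp
    refine (h1.mul (hy s)).congr_deriv ?_
    ring
  have hi := intervalIntegral.integral_eq_sub_of_hasDerivAt (a := a) (b := b) (fun s _ => hd s)
    (Continuous.intervalIntegrable (by fun_prop) _ _)
  have h2 : ‖y b‖ = ‖Complex.exp (-(I * Θ b)) * y b‖ := by rw [norm_mul, hn, one_mul]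
  have h3 : ‖y a‖ = ‖Complex.exp (-(I * Θ a)) * y a‖ := by rw [norm_mul, hn, one_mul]
  rw [h2, h3, ← sub_add_cancel (Complex.exp (-(I * Θ b)) * y b) (Complex.exp (-(I * Θ a)) * y a),
    ← hi, add_comm]
  refine (norm_add_le _ _).trans (add_le_add_right ?_ _)
  refine (intervalIntegral.norm_integral_le_abs_integral_norm).trans (le_of_eq ?_)
  simp_rw [norm_mul, hn, one_mul]

/-- The angle by which the solution of the transport equation has rotated. -/
noncomputable def phase (κ : ℝ → ℝ → ℝ) (M : ℝ → ℝ → ℂ) (u v : ℝ) : ℝ :=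
  ∫ s in -v..u, κ s v * (M s v).im

/-- The solution `P` of `P_u = α M + I κ (Im M) P` with `P = P₀` on the line `u + v = 0`. -/
noncomputable def transport (α κ : ℝ → ℝ → ℝ) (P₀ : ℝ → ℂ) (M : ℝ → ℝ → ℂ) (u v : ℝ) : ℂ :=
  Complex.exp (I * phase κ M u v) *
    (P₀ v + ∫ s in -v..u, Complex.exp (-(I * phase κ M s v)) * (α s v * M s v))

variable {α κ : ℝ → ℝ → ℝ} {P₀ : ℝ → ℂ} {M : ℝ → ℝ → ℂ}

theorem continuous_phase_integrand (hκ : Continuous fun p : ℝ × ℝ => κ p.1 p.2)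
    (hM : Continuous fun p : ℝ × ℝ => M p.1 p.2) :
    Continuous fun p : ℝ × ℝ => κ p.1 p.2 * (M p.1 p.2).im :=
  hκ.mul (Complex.continuous_im.comp hM)

theorem continuous_phase (hκ : Continuous fun p : ℝ × ℝ => κ p.1 p.2)
    (hM : Continuous fun p : ℝ × ℝ => M p.1 p.2) :
    Continuous fun p : ℝ × ℝ => phase κ M p.1 p.2 :=
  continuous_integral_line (g := fun s v => κ s v * (M s v).im) (continuous_phase_integrand hκ hM)

theorem continuous_transport_integrand (hα : Continuous fun p : ℝ × ℝ => α p.1 p.2)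
    (hκ : Continuous fun p : ℝ × ℝ => κ p.1 p.2) (hM : Continuous fun p : ℝ × ℝ => M p.1 p.2) :
    Continuous fun p : ℝ × ℝ =>
      Complex.exp (-(I * phase κ M p.1 p.2)) * (α p.1 p.2 * M p.1 p.2) := by
  have := continuous_phase hκ hM
  fun_prop

theorem continuous_transport (hα : Continuous fun p : ℝ × ℝ => α p.1 p.2)
    (hκ : Continuous fun p : ℝ × ℝ => κ p.1 p.2) (hP₀ : Continuous P₀)
    (hM : Continuous fun p : ℝ × ℝ => M p.1 p.2) :
    Continuous fun p : ℝ × ℝ => transport α κ P₀ M p.1 p.2 := by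
  have h1 := continuous_phase hκ hM
  have h2 := continuous_integral_line
    (g := fun s v => Complex.exp (-(I * phase κ M s v)) * (α s v * M s v))
    (continuous_transport_integrand hα hκ hM)
  unfold transport
  fun_prop

theorem transport_neg (v : ℝ) : transport α κ P₀ M (-v) v = P₀ v := by
  simp [transport, phase]

theorem hasDerivAt_transport (hα : Continuous fun p : ℝ × ℝ => α p.1 p.2)
    (hκ : Continuous fun p : ℝ × ℝ => κ p.1 p.2)
    (hM : Continuous fun p : ℝ × ℝ => M p.1 p.2) (u v : ℝ) :
    HasDerivAt (fun s => transport α κ P₀ M s v)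
      (α u v * M u v + I * (κ u v * (M u v).im : ℝ) * transport α κ P₀ M u v) u := by
  have h1 : HasDerivAt (fun s => phase κ M s v) (κ u v * (M u v).im) u :=
    hasDerivAt_integral_line_left (g := fun s v => κ s v * (M s v).im)
      (continuous_phase_integrand hκ hM) u v
  have h2 := (hasDerivAt_integral_line_left
    (g := fun s v => Complex.exp (-(I * phase κ M s v)) * (α s v * M s v))
    (continuous_transport_integrand hα hκ hM) u v).const_add (P₀ v)
  have h3 := ((h1.ofReal_comp.const_mul I).cexp).mul h2
  refine h3.congr_deriv ?_
  rw [← mul_assoc (Complex.exp _) (Complex.exp _), ← Complex.exp_add, add_neg_cancel,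
    Complex.exp_zero, one_mul, transport]
  ring

/-- Only the `v`-derivative of `M` is required: the integrals run in the `u`-direction. -/
theorem contDiff_transport (hα : ContDiff ℝ 1 fun p : ℝ × ℝ => α p.1 p.2)
    (hκ : ContDiff ℝ 1 fun p : ℝ × ℝ => κ p.1 p.2) (hP₀ : ContDiff ℝ 1 P₀)
    (hM : Continuous fun p : ℝ × ℝ => M p.1 p.2) {Mv : ℝ → ℝ → ℂ}
    (hMv : Continuous fun p : ℝ × ℝ => Mv p.1 p.2)
    (hd : ∀ u v, HasDerivAt (fun s => M u s) (Mv u v) v) :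
    ContDiff ℝ 1 fun p : ℝ × ℝ => transport α κ P₀ M p.1 p.2 := by
  obtain ⟨-, αv, -, hαv, -, cαv⟩ := exists_partials (n := 0) (by simpa using hα)
  obtain ⟨-, κv, -, hκv, -, cκv⟩ := exists_partials (n := 0) (by simpa using hκ)
  replace cαv : Continuous fun p : ℝ × ℝ => αv p.1 p.2 := cαv.continuous
  replace cκv : Continuous fun p : ℝ × ℝ => κv p.1 p.2 := cκv.continuous
  have cα := hα.continuous
  have cκ := hκ.continuous
  have hphase : ContDiff ℝ 1 fun p : ℝ × ℝ => phase κ M p.1 p.2 := by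
    refine contDiff_integral_line (g := fun s v => κ s v * (M s v).im)
      (gv := fun s v => κv s v * (M s v).im + κ s v * (Mv s v).im)
      (continuous_phase_integrand cκ hM) (by fun_prop) fun s v => ?_
    exact (hκv s v).mul (Complex.imCLM.hasFDerivAt.comp_hasDerivAt v (hd s v))
  obtain ⟨-, φv, -, hφv, -, cφv⟩ := exists_partials (n := 0) (by simpa using hphase)
  replace cφv : Continuous fun p : ℝ × ℝ => φv p.1 p.2 := cφv.continuous
  have cφ := hphase.continuous
  have hint := contDiff_integral_line
    (g := fun s v => Complex.exp (-(I * phase κ M s v)) * (α s v * M s v))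
    (gv := fun s v => Complex.exp (-(I * phase κ M s v)) * (-(I * φv s v)) * (α s v * M s v)
      + Complex.exp (-(I * phase κ M s v)) * (αv s v * M s v + α s v * Mv s v))
    (continuous_transport_integrand cα cκ hM) (by fun_prop) fun s v =>
      (((hφv s v).ofReal_comp.const_mul I).neg.cexp).mul ((hαv s v).ofReal_comp.mul (hd s v))
  have hφC : ContDiff ℝ 1 fun p : ℝ × ℝ => (phase κ M p.1 p.2 : ℂ) :=
    Complex.ofRealCLM.contDiff.comp hphase
  exact (contDiff_const.mul hφC).cexp.mul ((hP₀.comp contDiff_snd).add hint)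

/-- The coefficient `κ` is absent from the bound because it enters only through a rotation; the
estimate is therefore linear in `M` although the equation is quadratic. -/
theorem norm_transport_le (hα : Continuous fun p : ℝ × ℝ => α p.1 p.2)
    (hκ : Continuous fun p : ℝ × ℝ => κ p.1 p.2)
    (hM : Continuous fun p : ℝ × ℝ => M p.1 p.2) (u v : ℝ) :
    ‖transport α κ P₀ M u v‖ ≤ ‖P₀ v‖ + |∫ s in -v..u, ‖(α s v : ℂ) * M s v‖| := by
  have cl : Continuous fun s : ℝ => (s, v) := Continuous.prodMk_left v
  have := norm_le_of_rotation (y := fun s => transport α κ P₀ M s v)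
    (f := fun s => α s v * M s v) (θ := fun s => κ s v * (M s v).im)
    ((Complex.continuous_ofReal.comp (hα.comp cl)).mul (hM.comp cl))
    ((continuous_phase_integrand hκ hM).comp cl)
    (fun s => hasDerivAt_transport hα hκ hM s v) (-v) u
  rwa [transport_neg] at this

/-- The difference of the two solutions is itself rotated by `κ Im M`. What remains of the quadratic
term is a source linear in `M - M'`, multiplied by the second solution alone, so a bound for only
one of the two is needed. -/
theorem norm_transport_sub_le (hα : Continuous fun p : ℝ × ℝ => α p.1 p.2)
    (hκ : Continuous fun p : ℝ × ℝ => κ p.1 p.2) (hP₀ : Continuous P₀)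
    (hM : Continuous fun p : ℝ × ℝ => M p.1 p.2) {M' : ℝ → ℝ → ℂ}
    (hM' : Continuous fun p : ℝ × ℝ => M' p.1 p.2) (u v : ℝ) :
    ‖transport α κ P₀ M u v - transport α κ P₀ M' u v‖ ≤
      |∫ s in -v..u, ‖(α s v : ℂ) * (M s v - M' s v)
        + I * (κ s v * (M s v - M' s v).im : ℝ) * transport α κ P₀ M' s v‖| := by
  have cl : Continuous fun s : ℝ => (s, v) := Continuous.prodMk_left v
  have cT : Continuous fun s => transport α κ P₀ M' s v :=
    (continuous_transport hα hκ hP₀ hM').comp cl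
  have cα : Continuous fun s => α s v := hα.comp cl
  have cκ : Continuous fun s => κ s v := hκ.comp cl
  have cM : Continuous fun s => M s v := hM.comp cl
  have cM' : Continuous fun s => M' s v := hM'.comp cl
  have := norm_le_of_rotation
    (y := fun s => transport α κ P₀ M s v - transport α κ P₀ M' s v)
    (f := fun s => (α s v : ℂ) * (M s v - M' s v)
        + I * (κ s v * (M s v - M' s v).im : ℝ) * transport α κ P₀ M' s v)
    (θ := fun s => κ s v * (M s v).im) (by fun_prop)
    ((continuous_phase_integrand hκ hM).comp cl)
    (fun s => ((hasDerivAt_transport hα hκ hM s v).sub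
      (hasDerivAt_transport hα hκ hM' s v)).congr_deriv (by
        push_cast [Complex.sub_im]; ring)) (-v) u
  simpa only [transport_neg, sub_self, norm_zero, zero_add] using this

/-- The bound `‖F u v‖ ≤ C exp (μ |u + v|)` on the square `|u|, |v| ≤ X`. -/
def ExpBounded (X μ C : ℝ) (F : ℝ → ℝ → ℂ) : Prop :=
  ∀ u v, |u| ≤ X → |v| ≤ X → ‖F u v‖ ≤ C * Real.exp (μ * |u + v|)

theorem ExpBounded.flip {X μ C : ℝ} {F : ℝ → ℝ → ℂ} (h : ExpBounded X μ C F) :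
    ExpBounded X μ C (flip F) := fun u v hu hv => by
  rw [add_comm]; exact h v u hv hu

/-- Characteristic segments issuing from the line `u + v = 0` to a point of the square stay in the
square, so all estimates localise to squares. -/
theorem abs_le_of_mem_uIcc_neg {X u v s : ℝ} (hu : |u| ≤ X) (hv : |v| ≤ X)
    (hs : s ∈ uIcc (-v) u) : |s| ≤ X := by
  have : uIcc (-v) u ⊆ Icc (-X) X := by
    rw [abs_le] at hu hv
    exact uIcc_subset_Icc ⟨by linarith, by linarith⟩ hu
  exact abs_le.2 (this hs)

/-- The data contribute at most `D`, and the integral at most `2 A D / μ ≤ D` times the weight;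
together they give back `2 D`. The weight does not depend on the size of the data. -/
theorem ExpBounded.transport {X μ A D : ℝ} (hα : Continuous fun p : ℝ × ℝ => α p.1 p.2)
    (hκ : Continuous fun p : ℝ × ℝ => κ p.1 p.2)
    (hM : Continuous fun p : ℝ × ℝ => M p.1 p.2)
    (hA : ∀ u v, |u| ≤ X → |v| ≤ X → |α u v| ≤ A) (hA0 : 0 ≤ A) (hμ : 0 < μ) (hAμ : 2 * A ≤ μ)
    (hD : ∀ v, |v| ≤ X → ‖P₀ v‖ ≤ D) (hD0 : 0 ≤ D) (h : ExpBounded X μ (2 * D) M) :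
    ExpBounded X μ (2 * D) (transport α κ P₀ M) := fun u v hu hv => by
  have cl : Continuous fun s : ℝ => (s, v) := Continuous.prodMk_left v
  have h1 := abs_integral_norm_le_exp (f := fun s => (α s v : ℂ) * M s v) (a := -v) (b := u)
    (C := A * (2 * D)) (μ := μ)
    ((Complex.continuous_ofReal.comp (hα.comp cl)).mul (hM.comp cl)) (by positivity) hμ
    (fun s hs => by
      have hs' := abs_le_of_mem_uIcc_neg hu hv hs
      rw [norm_mul, Complex.norm_real, Real.norm_eq_abs, mul_assoc, sub_neg_eq_add]
      exact mul_le_mul (hA s v hs' hv) (h s v hs' hv) (norm_nonneg _) hA0)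
  have h2 := norm_transport_le (P₀ := P₀) hα hκ hM u v
  have h3 : A * (2 * D) / μ ≤ D := by
    rw [div_le_iff₀ hμ]; nlinarith
  rw [sub_neg_eq_add] at h1
  have h4 : 1 ≤ Real.exp (μ * |u + v|) := Real.one_le_exp (by positivity)
  have h5 := hD v hv
  nlinarith [mul_le_mul_of_nonneg_right h3 (zero_le_one.trans h4)]

/-- The source of the difference is at most `(A + k B)` times the difference of the inputs, and the
gain `1 / μ` from the weight turns this into a factor `1 / 2`. -/
theorem ExpBounded.transport_sub {X μ A k B ε : ℝ} (hα : Continuous fun p : ℝ × ℝ => α p.1 p.2)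
    (hκ : Continuous fun p : ℝ × ℝ => κ p.1 p.2) (hP₀ : Continuous P₀)
    (hM : Continuous fun p : ℝ × ℝ => M p.1 p.2) {M' : ℝ → ℝ → ℂ}
    (hM' : Continuous fun p : ℝ × ℝ => M' p.1 p.2)
    (hA : ∀ u v, |u| ≤ X → |v| ≤ X → |α u v| ≤ A) (hA0 : 0 ≤ A)
    (hk : ∀ u v, |u| ≤ X → |v| ≤ X → |κ u v| ≤ k) (hk0 : 0 ≤ k)
    (hB : ∀ u v, |u| ≤ X → |v| ≤ X → ‖DoubleCusp.transport α κ P₀ M' u v‖ ≤ B) (hB0 : 0 ≤ B)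
    (hμ : 0 < μ) (hAμ : 2 * (A + k * B) ≤ μ) (hε : 0 ≤ ε)
    (h : ExpBounded X μ ε (fun u v => M u v - M' u v)) :
    ExpBounded X μ (ε / 2) (fun u v =>
      DoubleCusp.transport α κ P₀ M u v - DoubleCusp.transport α κ P₀ M' u v) := fun u v hu hv => by
  have cl : Continuous fun s : ℝ => (s, v) := Continuous.prodMk_left v
  have cT : Continuous fun s => DoubleCusp.transport α κ P₀ M' s v :=
    (continuous_transport hα hκ hP₀ hM').comp cl
  have cα : Continuous fun s => α s v := hα.comp cl
  have cκ : Continuous fun s => κ s v := hκ.comp cl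
  have cM : Continuous fun s => M s v := hM.comp cl
  have cM' : Continuous fun s => M' s v := hM'.comp cl
  refine (norm_transport_sub_le hα hκ hP₀ hM hM' u v).trans ?_
  refine (abs_integral_norm_le_exp (C := (A + k * B) * ε) (μ := μ) (by fun_prop) (by positivity) hμ
    fun s hs => ?_).trans ?_
  · have hs' := abs_le_of_mem_uIcc_neg hu hv hs
    rw [sub_neg_eq_add]
    have e1 := h s v hs' hv
    set E := ε * Real.exp (μ * |s + v|) with hEdef
    have hE : 0 ≤ E := (norm_nonneg _).trans e1
    have n1 : ‖(α s v : ℂ) * (M s v - M' s v)‖ ≤ A * E := by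
      rw [norm_mul, Complex.norm_real]
      exact mul_le_mul (hA s v hs' hv) e1 (norm_nonneg _) hA0
    have n2 : ‖I * (κ s v * (M s v - M' s v).im : ℝ) * DoubleCusp.transport α κ P₀ M' s v‖
        ≤ k * E * B := by
      rw [norm_mul, norm_mul, Complex.norm_I, one_mul, Complex.norm_real, norm_mul]
      refine mul_le_mul (mul_le_mul (hk s v hs' hv) ?_ (norm_nonneg _) hk0)
        (hB s v hs' hv) (norm_nonneg _) (by positivity)
      exact (Complex.abs_im_le_norm _).trans e1
    calc _ ≤ A * E + k * E * B := (norm_add_le _ _).trans (add_le_add n1 n2)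
      _ = (A + k * B) * ε * Real.exp (μ * |s + v|) := by rw [hEdef]; ring
  · rw [sub_neg_eq_add]
    refine mul_le_mul_of_nonneg_right ?_ (Real.exp_nonneg _)
    rw [div_le_iff₀ hμ]
    nlinarith

end Transport

/-! ### Global solution of the frame system by Picard iteration -/

section Frame

open Complex (I)

theorem exists_bound_on_square {E : Type*} [NormedAddCommGroup E] {F : ℝ → ℝ → E}
    (hF : Continuous fun p : ℝ × ℝ => F p.1 p.2) (X : ℝ) :
    ∃ C, 0 ≤ C ∧ ∀ u v, |u| ≤ X → |v| ≤ X → ‖F u v‖ ≤ C := by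
  obtain ⟨C, hC⟩ := ((isCompact_Icc (a := -X) (b := X)).prod (isCompact_Icc (a := -X) (b := X)))
    |>.exists_bound_of_continuousOn hF.continuousOn
  exact ⟨max C 0, le_max_right _ _, fun u v hu hv =>
    (hC (u, v) ⟨abs_le.1 hu, abs_le.1 hv⟩).trans (le_max_left _ _)⟩

theorem continuous_flip {E : Type*} [TopologicalSpace E] {F : ℝ → ℝ → E}
    (hF : Continuous fun p : ℝ × ℝ => F p.1 p.2) :
    Continuous fun p : ℝ × ℝ => flip F p.1 p.2 :=
  hF.comp continuous_swap

theorem contDiff_flip {E : Type*} [NormedAddCommGroup E] [NormedSpace ℝ E] {F : ℝ → ℝ → E}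
    {n : WithTop ℕ∞} (hF : ContDiff ℝ n fun p : ℝ × ℝ => F p.1 p.2) :
    ContDiff ℝ n fun p : ℝ × ℝ => flip F p.1 p.2 :=
  hF.comp (contDiff_snd.prodMk contDiff_fst)

/-- One step of the Picard iteration for the pair of transport equations. -/
noncomputable def picard (α β κ : ℝ → ℝ → ℝ) (P₀ M₀ : ℝ → ℂ) (P : ℝ → ℝ → ℂ) : ℝ → ℝ → ℂ :=
  transport α κ P₀ (flip (transport (flip β) (flip κ) M₀ (flip P)))

variable {α β κ : ℝ → ℝ → ℝ} {P₀ M₀ : ℝ → ℂ}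

theorem continuous_transport_flip (hβ : Continuous fun p : ℝ × ℝ => β p.1 p.2)
    (hκ : Continuous fun p : ℝ × ℝ => κ p.1 p.2) (hM₀ : Continuous M₀) {P : ℝ → ℝ → ℂ}
    (hP : Continuous fun p : ℝ × ℝ => P p.1 p.2) :
    Continuous fun p : ℝ × ℝ =>
      flip (transport (flip β) (flip κ) M₀ (flip P)) p.1 p.2 :=
  continuous_flip (continuous_transport (continuous_flip hβ) (continuous_flip hκ) hM₀
    (continuous_flip hP))

theorem continuous_picard (hα : Continuous fun p : ℝ × ℝ => α p.1 p.2)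
    (hβ : Continuous fun p : ℝ × ℝ => β p.1 p.2)
    (hκ : Continuous fun p : ℝ × ℝ => κ p.1 p.2) (hP₀ : Continuous P₀) (hM₀ : Continuous M₀)
    {P : ℝ → ℝ → ℂ} (hP : Continuous fun p : ℝ × ℝ => P p.1 p.2) :
    Continuous fun p : ℝ × ℝ => picard α β κ P₀ M₀ P p.1 p.2 :=
  continuous_transport hα hκ hP₀ (continuous_transport_flip hβ hκ hM₀ hP)

/-- Two weights are needed. The first, `μ₀`, depends only on the linear coefficients and gives an
invariant set, by the rotation structure. The resulting sup bound then fixes the second weight `μ`,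
for which each half-step contracts by `1 / 2`. -/
theorem picard_estimates (hα : Continuous fun p : ℝ × ℝ => α p.1 p.2)
    (hβ : Continuous fun p : ℝ × ℝ => β p.1 p.2)
    (hκ : Continuous fun p : ℝ × ℝ => κ p.1 p.2) (hP₀ : Continuous P₀) (hM₀ : Continuous M₀)
    (X : ℝ) : ∃ μ₀ μ C : ℝ, 0 < μ₀ ∧ 0 < μ ∧ 0 ≤ C ∧
      (∀ P : ℝ → ℝ → ℂ, (Continuous fun p : ℝ × ℝ => P p.1 p.2) → ExpBounded X μ₀ C P →
        ExpBounded X μ₀ C (picard α β κ P₀ M₀ P)) ∧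
      ∀ P P' : ℝ → ℝ → ℂ, (Continuous fun p : ℝ × ℝ => P p.1 p.2) →
        (Continuous fun p : ℝ × ℝ => P' p.1 p.2) → ExpBounded X μ₀ C P' → ∀ ε, 0 ≤ ε →
        ExpBounded X μ ε (fun u v => P u v - P' u v) →
        ExpBounded X μ (ε / 4)
          (fun u v => picard α β κ P₀ M₀ P u v - picard α β κ P₀ M₀ P' u v) := by
  obtain ⟨a, ha0, ha⟩ := exists_bound_on_square hα X
  obtain ⟨b, hb0, hb⟩ := exists_bound_on_square hβ X
  obtain ⟨k, hk0, hk⟩ := exists_bound_on_square hκ X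
  obtain ⟨c, hc0, hc⟩ := exists_bound_on_square (F := fun _ v => P₀ v) (hP₀.comp continuous_snd) X
  obtain ⟨d, hd0, hd⟩ := exists_bound_on_square (F := fun _ v => M₀ v) (hM₀.comp continuous_snd) X
  have hA : ∀ u v, |u| ≤ X → |v| ≤ X → |α u v| ≤ a + b :=
    fun u v hu hv => (ha u v hu hv).trans (by linarith)
  have hA' : ∀ u v, |u| ≤ X → |v| ≤ X → |flip β u v| ≤ a + b :=
    fun u v hu hv => (hb v u hv hu).trans (by linarith)
  have hk' : ∀ u v, |u| ≤ X → |v| ≤ X → |flip κ u v| ≤ k := fun u v hu hv => hk v u hv hu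
  have hD : ∀ v, |v| ≤ X → ‖P₀ v‖ ≤ c + d := fun v hv => (hc v v hv hv).trans (by linarith)
  have hD' : ∀ v, |v| ≤ X → ‖M₀ v‖ ≤ c + d := fun v hv => (hd v v hv hv).trans (by linarith)
  set μ₀ := 2 * (a + b) + 1 with hμ₀
  have hμ₀0 : 0 < μ₀ := by positivity
  -- On the square `|u + v| ≤ 2 X`, so `B` is the unweighted bound that follows from `ExpBounded X
  -- μ₀`.
  set B := 2 * (c + d) * Real.exp (μ₀ * (2 * X)) with hBdef
  set μ := 2 * (a + b + k * B) + 1 with hμ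
  have hB0 : 0 ≤ B := by positivity
  have hμ0 : 0 < μ := by positivity
  have hb2 : ∀ P : ℝ → ℝ → ℂ, (Continuous fun p : ℝ × ℝ => P p.1 p.2) →
      ExpBounded X μ₀ (2 * (c + d)) P →
      ExpBounded X μ₀ (2 * (c + d)) (transport (flip β) (flip κ) M₀ (flip P)) :=
    fun P hP h => h.flip.transport (continuous_flip hβ) (continuous_flip hκ) (continuous_flip hP)
      hA' (by positivity) hμ₀0 (by linarith) hD' (by positivity)
  have hb1 : ∀ P : ℝ → ℝ → ℂ, (Continuous fun p : ℝ × ℝ => P p.1 p.2) →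
      ExpBounded X μ₀ (2 * (c + d)) P →
      ExpBounded X μ₀ (2 * (c + d)) (picard α β κ P₀ M₀ P) :=
    fun P hP h => (hb2 P hP h).flip.transport hα hκ (continuous_transport_flip hβ hκ hM₀ hP)
      hA (by positivity) hμ₀0 (by linarith) hD (by positivity)
  have hle : ∀ F : ℝ → ℝ → ℂ, ExpBounded X μ₀ (2 * (c + d)) F →
      ∀ u v, |u| ≤ X → |v| ≤ X → ‖F u v‖ ≤ B := fun F hF u v hu hv => by
    refine (hF u v hu hv).trans ?_
    have : |u + v| ≤ 2 * X := (abs_add_le u v).trans (by linarith)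
    rw [hBdef]
    gcongr
  refine ⟨μ₀, μ, 2 * (c + d), hμ₀0, hμ0, by positivity, hb1, fun P P' hP hP' h ε hε hd => ?_⟩
  have s1 := ExpBounded.transport_sub (M := flip P) (M' := flip P') (continuous_flip hβ)
    (continuous_flip hκ) hM₀ (continuous_flip hP) (continuous_flip hP') hA' (by positivity) hk' hk0
    (hle _ (hb2 P' hP' h)) hB0 hμ0 (by linarith) hε hd.flip
  have s2 := ExpBounded.transport_sub hα hκ hP₀ (continuous_transport_flip hβ hκ hM₀ hP)
    (continuous_transport_flip hβ hκ hM₀ hP') hA (by positivity) hk hk0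
    (hle _ (hb1 P' hP' h)) hB0 hμ0 (by linarith) (by positivity) s1.flip
  rwa [div_div, show (2 : ℝ) * 2 = 4 by norm_num] at s2

/-- The iterates starting from zero are Cauchy at the geometric rate `1 / 4` on each square, with
only the constant depending on the square. One sequence thus converges locally uniformly on the
whole plane. -/
theorem exists_picard_fixedPoint (hα : Continuous fun p : ℝ × ℝ => α p.1 p.2)
    (hβ : Continuous fun p : ℝ × ℝ => β p.1 p.2)
    (hκ : Continuous fun p : ℝ × ℝ => κ p.1 p.2) (hP₀ : Continuous P₀) (hM₀ : Continuous M₀) :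
    ∃ P : ℝ → ℝ → ℂ, (Continuous fun p : ℝ × ℝ => P p.1 p.2) ∧ picard α β κ P₀ M₀ P = P := by
  set seq : ℕ → ℝ → ℝ → ℂ := fun n => (picard α β κ P₀ M₀)^[n] 0 with hseq
  have hsucc : ∀ n, seq (n + 1) = picard α β κ P₀ M₀ (seq n) := fun n =>
    Function.iterate_succ_apply' _ _ _
  have hcont : ∀ n, Continuous fun p : ℝ × ℝ => seq n p.1 p.2 := fun n => by
    induction n with
    | zero => exact continuous_const
    | succ n ih => rw [hsucc]; exact continuous_picard hα hβ hκ hP₀ hM₀ ih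
  have hgeo : ∀ X : ℝ, ∃ K : ℝ, 0 ≤ K ∧ ∀ n u v, |u| ≤ X → |v| ≤ X →
      dist (seq n u v) (seq (n + 1) u v) ≤ K * (1 / 4) ^ n := by
    intro X
    obtain ⟨μ₀, μ, C, hμ₀, hμ, hC, hbd, hlip⟩ := picard_estimates hα hβ hκ hP₀ hM₀ X
    have h1 : ∀ n, ExpBounded X μ₀ C (seq n) := fun n => by
      induction n with
      | zero =>
        intro u v _ _
        simp only [hseq, Function.iterate_zero, id, Pi.zero_apply, norm_zero]
        positivity
      | succ n ih => rw [hsucc]; exact hbd _ (hcont n) ih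
    have h2 : ∀ n, ExpBounded X μ (C * Real.exp (μ₀ * (2 * X)) * (1 / 4) ^ n)
        (fun u v => seq (n + 1) u v - seq n u v) := fun n => by
      induction n with
      | zero =>
        intro u v hu hv
        have e0 : seq 0 u v = 0 := rfl
        beta_reduce
        rw [e0, sub_zero, pow_zero, mul_one]
        refine (h1 1 u v hu hv).trans ?_
        have : |u + v| ≤ 2 * X := (abs_add_le u v).trans (by linarith)
        have e1 : 1 ≤ Real.exp (μ * |u + v|) := Real.one_le_exp (by positivity)
        calc C * Real.exp (μ₀ * |u + v|) ≤ C * Real.exp (μ₀ * (2 * X)) := by gcongr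
          _ ≤ _ := le_mul_of_one_le_right (by positivity) e1
      | succ n ih =>
        have := hlip _ _ (hcont (n + 1)) (hcont n) (h1 n) _ (by positivity) ih
        rw [← hsucc, ← hsucc] at this
        convert this using 1
        ring
    refine ⟨C * Real.exp (μ₀ * (2 * X)) * Real.exp (μ * (2 * X)), by positivity,
      fun n u v hu hv => ?_⟩
    rw [dist_comm, dist_eq_norm]
    refine (h2 n u v hu hv).trans ?_
    have : |u + v| ≤ 2 * X := (abs_add_le u v).trans (by linarith)
    calc _ ≤ C * Real.exp (μ₀ * (2 * X)) * (1 / 4) ^ n * Real.exp (μ * (2 * X)) := by gcongr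
      _ = _ := by ring
  have hlim : ∀ u v, ∃ z, Tendsto (fun n => seq n u v) atTop (𝓝 z) := fun u v => by
    obtain ⟨K, -, hK⟩ := hgeo (max |u| |v|)
    exact cauchySeq_tendsto_of_complete (cauchySeq_of_le_geometric (1 / 4) K (by norm_num)
      fun n => hK n u v (le_max_left _ _) (le_max_right _ _))
  choose P hP using hlim
  have hdist : ∀ X : ℝ, ∃ K : ℝ, 0 ≤ K ∧ ∀ n u v, |u| ≤ X → |v| ≤ X →
      dist (seq n u v) (P u v) ≤ K * (1 / 4) ^ n := fun X => by
    obtain ⟨K, hK0, hK⟩ := hgeo X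
    refine ⟨K / (1 - 1 / 4), by positivity, fun n u v hu hv => ?_⟩
    have := dist_le_of_le_geometric_of_tendsto (1 / 4) K (by norm_num)
      (fun n => hK n u v hu hv) (hP u v) n
    rwa [mul_div_right_comm] at this
  have hpow : ∀ K : ℝ, Tendsto (fun n : ℕ => K * (1 / 4 : ℝ) ^ n) atTop (𝓝 0) := fun K => by
    simpa using (tendsto_pow_atTop_nhds_zero_of_lt_one (r := (1 / 4 : ℝ)) (by norm_num)
      (by norm_num)).const_mul K
  have hPc : Continuous fun p : ℝ × ℝ => P p.1 p.2 := by
    have : TendstoLocallyUniformly (fun n (p : ℝ × ℝ) => seq n p.1 p.2)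
        (fun p : ℝ × ℝ => P p.1 p.2) atTop := by
      refine Metric.tendstoLocallyUniformly_iff.2 fun ε hε p => ?_
      obtain ⟨K, -, hK⟩ := hdist (‖p‖ + 1)
      refine ⟨Metric.closedBall 0 (‖p‖ + 1), ?_, ?_⟩
      · refine Metric.closedBall_mem_nhds_of_mem ?_
        simp
      · filter_upwards [(hpow K).eventually_lt_const hε] with n hn q hq
        rw [mem_closedBall_zero_iff] at hq
        rw [dist_comm]
        exact (hK n q.1 q.2 ((norm_fst_le q).trans hq) ((norm_snd_le q).trans hq)).trans_lt hn
    exact this.continuous (Frequently.of_forall hcont)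
  refine ⟨P, hPc, funext fun u => funext fun v => ?_⟩
  set X := max |u| |v|
  obtain ⟨μ₀, μ, C, hμ₀, hμ, hC, hbd, hlip⟩ := picard_estimates hα hβ hκ hP₀ hM₀ X
  have h1 : ∀ n, ExpBounded X μ₀ C (seq n) := fun n => by
    induction n with
    | zero =>
      intro u v _ _
      simp only [hseq, Function.iterate_zero, id, Pi.zero_apply, norm_zero]
      positivity
    | succ n ih => rw [hsucc]; exact hbd _ (hcont n) ih
  obtain ⟨K, hK0, hK⟩ := hdist X
  have h2 : ∀ n, ‖picard α β κ P₀ M₀ P u v - seq (n + 1) u v‖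
      ≤ (K * Real.exp (μ * |u + v|) / 4) * (1 / 4) ^ n := fun n => by
    rw [hsucc]
    refine (hlip P (seq n) hPc (hcont n) (h1 n) (K * (1 / 4) ^ n) (by positivity)
      (fun a b ha hb => ?_) u v (le_max_left _ _) (le_max_right _ _)).trans (le_of_eq (by ring))
    rw [← dist_eq_norm, dist_comm]
    exact (hK n a b ha hb).trans
      (le_mul_of_one_le_right (by positivity) (Real.one_le_exp (by positivity)))
  have h3 : Tendsto (fun n => seq (n + 1) u v) atTop (𝓝 (picard α β κ P₀ M₀ P u v)) := by
    rw [tendsto_iff_norm_sub_tendsto_zero]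
    exact squeeze_zero (fun _ => norm_nonneg _) (fun n => (norm_sub_rev _ _).trans_le (h2 n))
      (hpow _)
  exact tendsto_nhds_unique h3 ((tendsto_add_atTop_iff_nat 1).2 (hP u v))

/-- Global solvability of the frame system in null coordinates. -/
theorem exists_frame (hα : ContDiff ℝ 1 fun p : ℝ × ℝ => α p.1 p.2)
    (hβ : ContDiff ℝ 1 fun p : ℝ × ℝ => β p.1 p.2)
    (hκ : ContDiff ℝ 1 fun p : ℝ × ℝ => κ p.1 p.2)
    (hP₀ : ContDiff ℝ 1 P₀) (hM₀ : ContDiff ℝ 1 M₀) :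
    ∃ P M : ℝ → ℝ → ℂ, (ContDiff ℝ 1 fun p : ℝ × ℝ => P p.1 p.2) ∧
      (ContDiff ℝ 1 fun p : ℝ × ℝ => M p.1 p.2) ∧
      (∀ u v, HasDerivAt (fun s => P s v)
        (α u v * M u v + I * (κ u v * (M u v).im : ℝ) * P u v) u) ∧
      (∀ u v, HasDerivAt (fun s => M u s)
        (β u v * P u v + I * (κ u v * (P u v).im : ℝ) * M u v) v) ∧
      (∀ v, P (-v) v = P₀ v) ∧ ∀ u, M u (-u) = M₀ u := by
  have cα := hα.continuous
  have cβ := hβ.continuous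
  have cκ := hκ.continuous
  obtain ⟨P, hPc, hfix⟩ := exists_picard_fixedPoint cα cβ cκ hP₀.continuous hM₀.continuous
  set M := flip (transport (flip β) (flip κ) M₀ (flip P)) with hM
  have hMc : Continuous fun p : ℝ × ℝ => M p.1 p.2 :=
    continuous_transport_flip cβ cκ hM₀.continuous hPc
  have hPM : P = transport α κ P₀ M := hfix.symm
  have hMd : ∀ u v, HasDerivAt (fun s => M u s)
      (β u v * P u v + I * (κ u v * (P u v).im : ℝ) * M u v) v := fun u v =>
    hasDerivAt_transport (P₀ := M₀) (continuous_flip cβ) (continuous_flip cκ)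
      (continuous_flip hPc) v u
  have hPd : ∀ u v, HasDerivAt (fun s => P s v)
      (α u v * M u v + I * (κ u v * (M u v).im : ℝ) * P u v) u := fun u v => by
    rw [hPM]
    exact hasDerivAt_transport (P₀ := P₀) cα cκ hMc u v
  refine ⟨P, M, ?_, ?_, hPd, hMd, fun v => ?_, fun u => ?_⟩
  · rw [hPM]
    -- Bootstrap: the fixed point is known only to be continuous, but the equation for `M` makes
    -- `M_v` continuous, hence `P` is `C¹`; the same argument with `P_u` serves for `M`.
    exact contDiff_transport hα hκ hP₀ hMc (by fun_prop) hMd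
  · refine contDiff_flip (contDiff_transport (contDiff_flip hβ) (contDiff_flip hκ) hM₀
      (continuous_flip hPc) (Mv := fun v u => α u v * M u v + I * (κ u v * (M u v).im : ℝ) * P u v)
      ?_ fun v u => hPd u v)
    exact continuous_flip
      (F := fun u v => α u v * M u v + I * (κ u v * (M u v).im : ℝ) * P u v) (by fun_prop)
  · rw [hPM, transport_neg]
  · exact transport_neg (α := flip β) (κ := flip κ) (M := flip P) u

end Frame

/-! ### From the frame components back to `W` and `q` -/

section Reconstruction

open Complex (I)

/-- A closed `C¹` one-form `g du + f dv` on the plane has a `C²` potential with prescribed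
compatible values on the line `u + v = 0`. -/
theorem exists_potential {f g h : ℝ → ℝ → ℝ} {w : ℝ → ℝ}
    (hf : ContDiff ℝ 1 fun p : ℝ × ℝ => f p.1 p.2) (hg : ContDiff ℝ 1 fun p : ℝ × ℝ => g p.1 p.2)
    (hfu : ∀ u v, HasDerivAt (fun s => f s v) (h u v) u)
    (hgv : ∀ u v, HasDerivAt (fun s => g u s) (h u v) v)
    (hw : ∀ v, HasDerivAt w (f (-v) v - g (-v) v) v) :
    ∃ W : ℝ → ℝ → ℝ, (ContDiff ℝ 2 fun p : ℝ × ℝ => W p.1 p.2) ∧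
      (∀ u v, HasDerivAt (fun s => W s v) (g u v) u) ∧
      (∀ u v, HasDerivAt (fun s => W u s) (f u v) v) ∧ ∀ v, W (-v) v = w v := by
  have hh : Continuous fun p : ℝ × ℝ => h p.1 p.2 := by
    obtain ⟨-, gv, -, hgv', -, cgv⟩ := exists_partials (n := 0) (by simpa using hg)
    have : h = gv := funext fun u => funext fun v => (hgv u v).unique (hgv' u v)
    rw [this]
    exact cgv.continuous
  have hWu : ∀ u v, HasDerivAt (fun s => w v + ∫ r in -v..s, g r v) (g u v) u := fun u v =>
    (hasDerivAt_integral_line_left hg.continuous u v).const_add _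
  have hWv : ∀ u v, HasDerivAt (fun y => w y + ∫ r in -y..u, g r y) (f u v) v := fun u v => by
    refine ((hw v).add
      (hasDerivAt_integral_line_right hg.continuous hh hgv u v)).congr_deriv ?_
    have hc : Continuous fun s => h s v := hh.comp (Continuous.prodMk_left v)
    -- By closedness `g_v = h = f_u`, so the integral of `g_v` is `f u v - f (-v) v`; the boundary
    -- terms cancel against the derivative of `w`.
    rw [intervalIntegral.integral_eq_sub_of_hasDerivAt (fun s _ => hfu s v)
      (hc.intervalIntegrable _ _)]
    ring
  refine ⟨fun u v => w v + ∫ s in -v..u, g s v, ?_, hWu, hWv, fun v => by simp⟩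
  exact contDiff_succ_of_partials (n := 1) hWu hWv hg hf

/-- Solvability of the wave map equations in null coordinates `u = t - x`, `v = t + x`, with data
on the line `u + v = 0`. -/
theorem exists_null_solution {R Ru Rv : ℝ → ℝ → ℝ} {w₀ w₁ q₀ q₁ : ℝ → ℝ}
    (hR0 : ∀ u v, 0 < R u v) (hR : ContDiff ℝ 1 fun p : ℝ × ℝ => R p.1 p.2)
    (hRu : ∀ u v, HasDerivAt (fun s => R s v) (Ru u v) u)
    (hRv : ∀ u v, HasDerivAt (fun s => R u s) (Rv u v) v)
    (cRu : ContDiff ℝ 1 fun p : ℝ × ℝ => Ru p.1 p.2)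
    (cRv : ContDiff ℝ 1 fun p : ℝ × ℝ => Rv p.1 p.2)
    (hw₀ : ContDiff ℝ 2 w₀) (hq₀ : ContDiff ℝ 2 q₀)
    (hw₁ : ContDiff ℝ 1 w₁) (hq₁ : ContDiff ℝ 1 q₁) :
    ∃ W Wu Wv q qu qv : ℝ → ℝ → ℝ,
      (ContDiff ℝ 2 fun p : ℝ × ℝ => W p.1 p.2) ∧ (ContDiff ℝ 2 fun p : ℝ × ℝ => q p.1 p.2) ∧
      (∀ u v, HasDerivAt (fun s => W s v) (Wu u v) u) ∧
      (∀ u v, HasDerivAt (fun s => W u s) (Wv u v) v) ∧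
      (∀ u v, HasDerivAt (fun s => q s v) (qu u v) u) ∧
      (∀ u v, HasDerivAt (fun s => q u s) (qv u v) v) ∧
      (∀ u v, HasDerivAt (fun s => Wv s v)
        (-(Rv u v * Wu u v + Ru u v * Wv u v) / (2 * R u v)
          - Real.exp (-4 * W u v) * qu u v * qv u v / 2) u) ∧
      (∀ u v, HasDerivAt (fun s => qv s v)
        (-(Rv u v * qu u v + Ru u v * qv u v) / (2 * R u v)
          + 2 * (qv u v * Wu u v + qu u v * Wv u v)) u) ∧
      (∀ u v, HasDerivAt (fun s => Wu u s)
        (-(Rv u v * Wu u v + Ru u v * Wv u v) / (2 * R u v)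
          - Real.exp (-4 * W u v) * qu u v * qv u v / 2) v) ∧
      (∀ u v, HasDerivAt (fun s => qu u s)
        (-(Rv u v * qu u v + Ru u v * qv u v) / (2 * R u v)
          + 2 * (qv u v * Wu u v + qu u v * Wv u v)) v) ∧
      (ContDiff ℝ 1 fun p : ℝ × ℝ => Wu p.1 p.2) ∧ (ContDiff ℝ 1 fun p : ℝ × ℝ => Wv p.1 p.2) ∧
      (ContDiff ℝ 1 fun p : ℝ × ℝ => qu p.1 p.2) ∧ (ContDiff ℝ 1 fun p : ℝ × ℝ => qv p.1 p.2) ∧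
      (∀ v, W (-v) v = w₀ v) ∧ (∀ v, Wu (-v) v + Wv (-v) v = w₁ v) ∧
      (∀ v, q (-v) v = q₀ v) ∧ ∀ v, qu (-v) v + qv (-v) v = q₁ v := by
  set σ : ℝ → ℝ → ℝ := fun u v => √(R u v) with hσdef
  have hσ0 : ∀ u v, 0 < σ u v := fun u v => Real.sqrt_pos.2 (hR0 u v)
  have hσ2 : ∀ u v, R u v = σ u v ^ 2 := fun u v => (Real.sq_sqrt (hR0 u v).le).symm
  have cσ : ContDiff ℝ 1 fun p : ℝ × ℝ => σ p.1 p.2 := hR.sqrt fun p => (hR0 _ _).ne'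
  have hσu : ∀ u v, HasDerivAt (fun s => σ s v) (Ru u v / (2 * σ u v)) u := fun u v =>
    (hRu u v).sqrt (hR0 u v).ne'
  have hσv : ∀ u v, HasDerivAt (fun s => σ u s) (Rv u v / (2 * σ u v)) v := fun u v =>
    (hRv u v).sqrt (hR0 u v).ne'
  have cdw : ContDiff ℝ 1 (deriv w₀) := (contDiff_succ_iff_deriv (n := 1)).1 hw₀ |>.2.2
  have cdq : ContDiff ℝ 1 (deriv q₀) := (contDiff_succ_iff_deriv (n := 1)).1 hq₀ |>.2.2
  have cw₀ : ContDiff ℝ 1 w₀ := hw₀.of_le (by norm_num)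
  -- The value of `√R (W_v + I exp (-2W) q_v / 2)` at `t = 0`, where `W_v = (W_t + W_x) / 2` and `v
  -- = x`. In `M₀` the point of the initial line is `x = -u`.
  set P₀ : ℝ → ℂ := fun v => σ (-v) v * (((w₁ v + deriv w₀ v) / 2 : ℝ)
    + I * (Real.exp (-2 * w₀ v) * (q₁ v + deriv q₀ v) / 4 : ℝ)) with hP₀
  set M₀ : ℝ → ℂ := fun u => σ u (-u) * (((w₁ (-u) - deriv w₀ (-u)) / 2 : ℝ)
    + I * (Real.exp (-2 * w₀ (-u)) * (q₁ (-u) - deriv q₀ (-u)) / 4 : ℝ)) with hM₀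
  have cP₀ : ContDiff ℝ 1 P₀ := by
    have c1 : ContDiff ℝ 1 fun v => σ (-v) v := cσ.comp (contDiff_neg.prodMk contDiff_id)
    refine (Complex.ofRealCLM.contDiff.comp c1).mul ((Complex.ofRealCLM.contDiff.comp ?_).add
      (contDiff_const.mul (Complex.ofRealCLM.contDiff.comp ?_))) <;>
    exact ContDiff.div_const (by fun_prop) _
  have cM₀ : ContDiff ℝ 1 M₀ := by
    have c1 : ContDiff ℝ 1 fun v => σ v (-v) := cσ.comp (contDiff_id.prodMk contDiff_neg)
    refine (Complex.ofRealCLM.contDiff.comp c1).mul ((Complex.ofRealCLM.contDiff.comp ?_).add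
      (contDiff_const.mul (Complex.ofRealCLM.contDiff.comp ?_))) <;>
    exact ContDiff.div_const (by fun_prop) _
  obtain ⟨P, M, cP, cM, hPu, hMv, hPd, hMd⟩ := exists_frame
    -- The derivative of `√R` cancels the damping term in which `P_u` would be proportional to `P`,
    -- and likewise for `M_v`, so the real coefficients couple `P` only to `M`.
    (α := fun u v => -Rv u v / (2 * R u v)) (β := fun u v => -Ru u v / (2 * R u v))
    (κ := fun u v => 2 / σ u v)
    (cRv.neg.div (contDiff_const.mul hR) fun p => by have := hR0 p.1 p.2; positivity)
    (cRu.neg.div (contDiff_const.mul hR) fun p => by have := hR0 p.1 p.2; positivity)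
    (contDiff_const.div cσ fun p => (hσ0 p.1 p.2).ne') cP₀ cM₀
  have cre : ∀ {F : ℝ → ℝ → ℂ}, (ContDiff ℝ 1 fun p : ℝ × ℝ => F p.1 p.2) →
      ContDiff ℝ 1 fun p : ℝ × ℝ => (F p.1 p.2).re / σ p.1 p.2 := fun hF =>
    (Complex.reCLM.contDiff.comp hF).div cσ fun p => (hσ0 p.1 p.2).ne'
  have cim : ∀ {F : ℝ → ℝ → ℂ}, (ContDiff ℝ 1 fun p : ℝ × ℝ => F p.1 p.2) →
      ContDiff ℝ 1 fun p : ℝ × ℝ => (F p.1 p.2).im / σ p.1 p.2 := fun hF =>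
    (Complex.imCLM.contDiff.comp hF).div cσ fun p => (hσ0 p.1 p.2).ne'
  set p : ℝ → ℝ → ℝ := fun u v => (P u v).re / σ u v with hp
  set a : ℝ → ℝ → ℝ := fun u v => (P u v).im / σ u v with ha
  set m : ℝ → ℝ → ℝ := fun u v => (M u v).re / σ u v with hm
  set b : ℝ → ℝ → ℝ := fun u v => (M u v).im / σ u v with hb
  have hpu : ∀ u v, HasDerivAt (fun s => p s v)
      (-(Rv u v * m u v + Ru u v * p u v) / (2 * R u v) - 2 * a u v * b u v) u := fun u v => by
    refine ((Complex.reCLM.hasFDerivAt.comp_hasDerivAt u (hPu u v)).div (hσu u v)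
      (hσ0 u v).ne').congr_deriv ?_
    have := (hσ0 u v).ne'
    simp [hp, hm, ha, hb, hσ2, -Complex.ofReal_div, -Complex.ofReal_mul, -Complex.ofReal_neg]
    field_simp
    ring
  have hau : ∀ u v, HasDerivAt (fun s => a s v)
      (-(Rv u v * b u v + Ru u v * a u v) / (2 * R u v) + 2 * b u v * p u v) u := fun u v => by
    refine ((Complex.imCLM.hasFDerivAt.comp_hasDerivAt u (hPu u v)).div (hσu u v)
      (hσ0 u v).ne').congr_deriv ?_
    have := (hσ0 u v).ne'
    simp [hp, ha, hb, hσ2, -Complex.ofReal_div, -Complex.ofReal_mul, -Complex.ofReal_neg]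
    field_simp
    ring
  have hmv : ∀ u v, HasDerivAt (fun s => m u s)
      (-(Rv u v * m u v + Ru u v * p u v) / (2 * R u v) - 2 * a u v * b u v) v := fun u v => by
    refine ((Complex.reCLM.hasFDerivAt.comp_hasDerivAt v (hMv u v)).div (hσv u v)
      (hσ0 u v).ne').congr_deriv ?_
    have := (hσ0 u v).ne'
    simp [hp, hm, ha, hb, hσ2, -Complex.ofReal_div, -Complex.ofReal_mul, -Complex.ofReal_neg]
    field_simp
    ring
  have hbv : ∀ u v, HasDerivAt (fun s => b u s)
      (-(Rv u v * b u v + Ru u v * a u v) / (2 * R u v) + 2 * a u v * m u v) v := fun u v => by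
    refine ((Complex.imCLM.hasFDerivAt.comp_hasDerivAt v (hMv u v)).div (hσv u v)
      (hσ0 u v).ne').congr_deriv ?_
    have := (hσ0 u v).ne'
    simp [hm, ha, hb, hσ2, -Complex.ofReal_div, -Complex.ofReal_mul, -Complex.ofReal_neg]
    field_simp
    ring
  have hp0 : ∀ v, p (-v) v = (w₁ v + deriv w₀ v) / 2 := fun v => by
    have := (hσ0 (-v) v).ne'
    simp only [hp, hPd, hP₀, Complex.re_ofReal_mul, Complex.add_re, Complex.ofReal_re,
      Complex.I_mul_re, Complex.ofReal_im, neg_zero, add_zero]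
    field_simp
  have ha0 : ∀ v, a (-v) v = Real.exp (-2 * w₀ v) * (q₁ v + deriv q₀ v) / 4 := fun v => by
    have := (hσ0 (-v) v).ne'
    simp only [ha, hPd, hP₀, Complex.im_ofReal_mul, Complex.add_im, Complex.ofReal_re,
      Complex.I_mul_im, Complex.ofReal_im, zero_add]
    field_simp
  have hMd' : ∀ v, M (-v) v = M₀ (-v) := fun v => by simpa using hMd (-v)
  have hm0 : ∀ v, m (-v) v = (w₁ v - deriv w₀ v) / 2 := fun v => by
    have := (hσ0 (-v) v).ne'
    simp only [hm, hMd', hM₀, Complex.re_ofReal_mul, Complex.add_re, Complex.ofReal_re,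
      Complex.I_mul_re, Complex.ofReal_im, neg_zero, add_zero, neg_neg]
    field_simp
  have hb0 : ∀ v, b (-v) v = Real.exp (-2 * w₀ v) * (q₁ v - deriv q₀ v) / 4 := fun v => by
    have := (hσ0 (-v) v).ne'
    simp only [hb, hMd', hM₀, Complex.im_ofReal_mul, Complex.add_im, Complex.ofReal_re,
      Complex.I_mul_im, Complex.ofReal_im, zero_add, neg_neg]
    field_simp
  -- The real parts satisfy `p_u = m_v`, which makes `m du + p dv` closed. The imaginary parts form
  -- a closed form only after multiplication by `2 exp (2W)`, so `W` has to be found before `q`.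
  obtain ⟨W, cW, hWu, hWv, hW0⟩ := exists_potential (w := w₀) (cre cP) (cre cM) hpu hmv fun v =>
    ((hw₀.differentiable (by norm_num) v).hasDerivAt).congr_deriv (by rw [hp0, hm0]; ring)
  have cW1 : ContDiff ℝ 1 fun p : ℝ × ℝ => W p.1 p.2 := cW.of_le (by norm_num)
  have cexpW : ContDiff ℝ 1 fun p : ℝ × ℝ => 2 * Real.exp (2 * W p.1 p.2) :=
    contDiff_const.mul (contDiff_const.mul cW1).exp
  set qv : ℝ → ℝ → ℝ := fun u v => 2 * Real.exp (2 * W u v) * a u v with hqv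
  set qu : ℝ → ℝ → ℝ := fun u v => 2 * Real.exp (2 * W u v) * b u v with hqu
  have hqvu : ∀ u v, HasDerivAt (fun s => qv s v)
        (-(Rv u v * qu u v + Ru u v * qv u v) / (2 * R u v)
          + 2 * (qv u v * m u v + qu u v * p u v)) u := fun u v => by
    refine ((((hWu u v).const_mul 2).exp.const_mul 2).mul (hau u v)).congr_deriv ?_
    have := (hR0 u v).ne'
    simp only [hqv, hqu, hm]
    field_simp
    ring
  have hquv : ∀ u v, HasDerivAt (fun s => qu u s)
        (-(Rv u v * qu u v + Ru u v * qv u v) / (2 * R u v)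
          + 2 * (qv u v * m u v + qu u v * p u v)) v := fun u v => by
    refine ((((hWv u v).const_mul 2).exp.const_mul 2).mul (hbv u v)).congr_deriv ?_
    have := (hR0 u v).ne'
    simp only [hqv, hqu, hp]
    field_simp
    ring
  have hexp0 : ∀ v, Real.exp (2 * w₀ v) * Real.exp (-2 * w₀ v) = 1 := fun v => by
    rw [← Real.exp_add]; simp
  have hqv0 : ∀ v, qv (-v) v = (q₁ v + deriv q₀ v) / 2 := fun v => by
    simp only [hqv, ha0, hW0]
    linear_combination (q₁ v + deriv q₀ v) / 2 * hexp0 v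
  have hqu0 : ∀ v, qu (-v) v = (q₁ v - deriv q₀ v) / 2 := fun v => by
    simp only [hqu, hb0, hW0]
    linear_combination (q₁ v - deriv q₀ v) / 2 * hexp0 v
  obtain ⟨q, cq, hqu', hqv', hq0⟩ := exists_potential (w := q₀) (f := qv) (g := qu)
    (cexpW.mul (cim cP)) (cexpW.mul (cim cM)) hqvu hquv fun v =>
    ((hq₀.differentiable (by norm_num) v).hasDerivAt).congr_deriv (by rw [hqv0, hqu0]; ring)
  have hnl : ∀ u v, -(Rv u v * m u v + Ru u v * p u v) / (2 * R u v) - 2 * a u v * b u v =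
      -(Rv u v * m u v + Ru u v * p u v) / (2 * R u v)
        - Real.exp (-4 * W u v) * qu u v * qv u v / 2 := fun u v => by
    have e : Real.exp (-4 * W u v) * Real.exp (2 * W u v) ^ 2 = 1 := by
      rw [← Real.exp_nat_mul, ← Real.exp_add]; simp; ring
    simp only [hqu, hqv]
    linear_combination (2 * a u v * b u v) * e
  refine ⟨W, m, p, q, qu, qv, cW, cq, hWu, hWv, hqu', hqv',
    fun u v => (hpu u v).congr_deriv (hnl u v), hqvu, fun u v => (hmv u v).congr_deriv (hnl u v),
    hquv, cre cM, cre cP, cexpW.mul (cim cM), cexpW.mul (cim cP), hW0, fun v => ?_,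
    hq0, fun v => ?_⟩
  · rw [hm0, hp0]; ring
  · rw [hqu0, hqv0]; ring

end Reconstruction

/-! ### Existence: null coordinates, d'Alembert's formula and positivity -/

section Existence

theorem dt_congr {f g : ℝ → ℝ → ℝ} (h : ∀ t, 0 ≤ t → ∀ x, f t x = g t x) :
    ∀ t, 0 ≤ t → ∀ x, dt f t x = dt g t x := fun t ht x =>
  derivWithin_congr (fun s hs => h s hs x) (h t ht x)

theorem dx_congr {f g : ℝ → ℝ → ℝ} (h : ∀ t, 0 ≤ t → ∀ x, f t x = g t x) :
    ∀ t, 0 ≤ t → ∀ x, dx f t x = dx g t x := fun t ht x => by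
  have : f t = g t := funext (h t ht)
  simp only [dx, this]

/-- The function of `(t, x)` given by `F` in the null coordinates `u = t - x`, `v = t + x`. -/
def ofNull (F : ℝ → ℝ → ℝ) (t x : ℝ) : ℝ := F (t - x) (t + x)

theorem contDiff_ofNull {F : ℝ → ℝ → ℝ} {n : WithTop ℕ∞}
    (hF : ContDiff ℝ n fun p : ℝ × ℝ => F p.1 p.2) :
    ContDiff ℝ n fun p : ℝ × ℝ => ofNull F p.1 p.2 :=
  hF.comp ((contDiff_fst.sub contDiff_snd).prodMk (contDiff_fst.add contDiff_snd))

variable {F Fu Fv : ℝ → ℝ → ℝ}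

theorem dt_ofNull (hu : ∀ u v, HasDerivAt (fun s => F s v) (Fu u v) u)
    (hv : ∀ u v, HasDerivAt (fun s => F u s) (Fv u v) v)
    (cu : Continuous fun p : ℝ × ℝ => Fu p.1 p.2) (cv : Continuous fun p : ℝ × ℝ => Fv p.1 p.2)
    {t : ℝ} (ht : 0 ≤ t) (x : ℝ) :
    dt (ofNull F) t x = ofNull (fun u v => Fu u v + Fv u v) t x := by
  have h := (hasFDerivAt_of_partials hu hv cu cv (t - x, t + x)).comp_hasDerivAt
    (f := fun s => ((s - x, s + x) : ℝ × ℝ)) t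
    (((hasDerivAt_id t).sub_const x).prodMk ((hasDerivAt_id t).add_const x))
  refine (h.hasDerivWithinAt.derivWithin (uniqueDiffOn_Ici 0 t ht)).trans ?_
  simp [ofNull]

theorem dx_ofNull (hu : ∀ u v, HasDerivAt (fun s => F s v) (Fu u v) u)
    (hv : ∀ u v, HasDerivAt (fun s => F u s) (Fv u v) v)
    (cu : Continuous fun p : ℝ × ℝ => Fu p.1 p.2) (cv : Continuous fun p : ℝ × ℝ => Fv p.1 p.2)
    (t x : ℝ) :
    dx (ofNull F) t x = ofNull (fun u v => Fv u v - Fu u v) t x := by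
  have h := (hasFDerivAt_of_partials hu hv cu cv (t - x, t + x)).comp_hasDerivAt
    (f := fun s => ((t - s, t + s) : ℝ × ℝ)) x
    (((hasDerivAt_id x).const_sub t).prodMk ((hasDerivAt_id x).const_add t))
  refine h.deriv.trans ?_
  simp [ofNull]
  ring

/-- Here `∂_t = ∂_u + ∂_v` and `∂_x = ∂_v - ∂_u`, so that `∂_t² - ∂_x² = 4 ∂_u ∂_v`. -/
theorem wave_ofNull {h : ℝ → ℝ → ℝ} (hu : ∀ u v, HasDerivAt (fun s => F s v) (Fu u v) u)
    (hv : ∀ u v, HasDerivAt (fun s => F u s) (Fv u v) v)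
    (cu : ContDiff ℝ 1 fun p : ℝ × ℝ => Fu p.1 p.2)
    (cv : ContDiff ℝ 1 fun p : ℝ × ℝ => Fv p.1 p.2)
    (huv : ∀ u v, HasDerivAt (fun s => Fu u s) (h u v) v)
    (hvu : ∀ u v, HasDerivAt (fun s => Fv s v) (h u v) u) {t : ℝ} (ht : 0 ≤ t) (x : ℝ) :
    dt (dt (ofNull F)) t x - dx (dx (ofNull F)) t x = 4 * ofNull h t x := by
  obtain ⟨Fuu, h', huu, huv', cuu, ch⟩ := exists_partials (n := 0) (by simpa using cu)
  obtain ⟨h'', Fvv, hvu', hvv, ch', cvv⟩ := exists_partials (n := 0) (by simpa using cv)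
  have e1 : h' = h := funext fun u => funext fun v => (huv' u v).unique (huv u v)
  have e2 : h'' = h := funext fun u => funext fun v => (hvu' u v).unique (hvu u v)
  subst e1 e2
  have hdx : dx (ofNull F) = ofNull fun u v => Fv u v - Fu u v :=
    funext fun t => funext fun x => dx_ofNull hu hv cu.continuous cv.continuous t x
  -- The formula for the inner time derivative is available only for nonnegative times, which is all
  -- that the outer one-sided derivative sees.
  rw [dt_congr (fun s hs y => dt_ofNull hu hv cu.continuous cv.continuous hs y) t ht x, hdx,
    dt_ofNull (F := fun u v => Fu u v + Fv u v) (fun u v => (huu u v).add (hvu u v)) (fun u v => (huv u v).add (hvv u v))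
      (cuu.continuous.add ch.continuous) (ch.continuous.add cvv.continuous) ht,
    dx_ofNull (F := fun u v => Fv u v - Fu u v) (fun u v => (hvu u v).sub (huu u v)) (fun u v => (hvv u v).sub (huv u v))
      (ch.continuous.sub cuu.continuous) (cvv.continuous.sub ch.continuous)]
  simp only [ofNull]
  ring

theorem hasData_ofNull (hu : ∀ u v, HasDerivAt (fun s => F s v) (Fu u v) u)
    (hv : ∀ u v, HasDerivAt (fun s => F u s) (Fv u v) v)
    (cu : Continuous fun p : ℝ × ℝ => Fu p.1 p.2) (cv : Continuous fun p : ℝ × ℝ => Fv p.1 p.2)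
    {f₀ f₁ : ℝ → ℝ} (h₀ : ∀ v, F (-v) v = f₀ v) (h₁ : ∀ v, Fu (-v) v + Fv (-v) v = f₁ v) :
    HasData (ofNull F) f₀ f₁ := fun x => by
  rw [dt_ofNull hu hv cu cv le_rfl]
  simp only [ofNull, zero_sub, zero_add]
  exact ⟨h₀ x, h₁ x⟩

/-- d'Alembert's solution of the wave equation, in null coordinates. -/
theorem exists_dAlembert {r₀ r₁ : ℝ → ℝ} (hr₀ : ContDiff ℝ 2 r₀) (hr₁ : ContDiff ℝ 1 r₁) :
    ∃ F Fu Fv : ℝ → ℝ → ℝ, (ContDiff ℝ 2 fun p : ℝ × ℝ => F p.1 p.2) ∧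
      (∀ u v, HasDerivAt (fun s => F s v) (Fu u v) u) ∧
      (∀ u v, HasDerivAt (fun s => F u s) (Fv u v) v) ∧
      (ContDiff ℝ 1 fun p : ℝ × ℝ => Fu p.1 p.2) ∧ (ContDiff ℝ 1 fun p : ℝ × ℝ => Fv p.1 p.2) ∧
      (∀ u v, HasDerivAt (fun s => Fu u s) 0 v) ∧ (∀ u v, HasDerivAt (fun s => Fv s v) 0 u) ∧
      (∀ v, F (-v) v = r₀ v) ∧ (∀ v, Fu (-v) v + Fv (-v) v = r₁ v) ∧
      ∀ u v, F u v = (r₀ v + r₀ (-u) + ∫ s in -u..v, r₁ s) / 2 := by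
  have cd : ContDiff ℝ 1 (deriv r₀) := (contDiff_succ_iff_deriv (n := 1)).1 hr₀ |>.2.2
  have hd : ∀ x, HasDerivAt r₀ (deriv r₀ x) x := fun x =>
    (hr₀.differentiable (by norm_num) x).hasDerivAt
  have c1 := hr₁.continuous
  have hv : ∀ u v : ℝ, HasDerivAt (fun y => (r₀ y + r₀ (-u) + ∫ s in -u..y, r₁ s) / 2)
      ((deriv r₀ v + r₁ v) / 2) v := fun u v =>
    (((hd v).add_const _).add (intervalIntegral.integral_hasDerivAt_right
      (c1.intervalIntegrable _ _) c1.aestronglyMeasurable.stronglyMeasurableAtFilter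
      c1.continuousAt)).div_const 2
  have hu : ∀ u v : ℝ, HasDerivAt (fun y => (r₀ v + r₀ (-y) + ∫ s in -y..v, r₁ s) / 2)
      ((r₁ (-u) - deriv r₀ (-u)) / 2) u := fun u v => by
    have h1 : HasDerivAt (fun y => ∫ s in y..v, r₁ s) (-r₁ (-u)) (-u) :=
      intervalIntegral.integral_hasDerivAt_left
        (c1.intervalIntegrable _ _) c1.aestronglyMeasurable.stronglyMeasurableAtFilter
        c1.continuousAt
    have h2 := h1.comp u (hasDerivAt_neg u)
    have h3 := (hd (-u)).comp u (hasDerivAt_neg u)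
    refine (((h3.const_add (r₀ v)).add h2).div_const 2).congr_deriv ?_
    ring
  have cu : ContDiff ℝ 1 fun p : ℝ × ℝ => (r₁ (-p.1) - deriv r₀ (-p.1)) / 2 :=
    ContDiff.div_const (by fun_prop) _
  have cv : ContDiff ℝ 1 fun p : ℝ × ℝ => (deriv r₀ p.2 + r₁ p.2) / 2 :=
    ContDiff.div_const (by fun_prop) _
  exact ⟨fun u v => (r₀ v + r₀ (-u) + ∫ s in -u..v, r₁ s) / 2,
    fun u v => (r₁ (-u) - deriv r₀ (-u)) / 2, fun u v => (deriv r₀ v + r₁ v) / 2,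
    contDiff_succ_of_partials (n := 1) hu hv cu cv, hu, hv, cu, cv,
    fun u v => hasDerivAt_const _ _, fun u v => hasDerivAt_const _ _,
    fun v => by simp, fun v => by simp only [neg_neg]; ring, fun _ _ => rfl⟩

theorem exists_bounds_of_m₀_lt {R₀ : ℝ} {r₀ r₁ : ℝ → ℝ}
    (hm : m₀ R₀ 0 r₀ r₁ < ENNReal.ofReal (2 * R₀ / 3)) :
    ∃ A B : ℝ, 0 ≤ A ∧ 0 ≤ B ∧ A + B < 2 * R₀ / 3 ∧
      (∀ x, |r₀ x - R₀ * Real.cosh (2 * x)| ≤ A) ∧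
      ∀ x, |r₁ x - 2 * R₀ * Real.cosh (2 * x)| ≤ B := by
  have hder : ∀ x, deriv (fun s => Rb R₀ s x) 0 = 2 * R₀ * Real.cosh (2 * x) := fun x => by
    have := ((((hasDerivAt_id (0 : ℝ)).const_mul 2).exp.const_mul R₀).mul_const
      (Real.cosh (2 * x))).deriv
    refine this.trans ?_
    simp only [id, mul_zero, Real.exp_zero]
    ring
  have hb : ∀ x, Rb R₀ 0 x = R₀ * Real.cosh (2 * x) := fun x => by simp [Rb]
  unfold m₀ at hm
  simp_rw [hder, hb] at hm
  set a := ⨆ x, ‖r₀ x - R₀ * Real.cosh (2 * x)‖ₑ with ha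
  set b := ⨆ x, ‖r₁ x - 2 * R₀ * Real.cosh (2 * x)‖ₑ with hb'
  have hab : a + b ≠ ⊤ := hm.ne_top
  have hat : a ≠ ⊤ := fun h => hab (by simp [h])
  have hbt : b ≠ ⊤ := fun h => hab (by simp [h])
  refine ⟨a.toReal, b.toReal, ENNReal.toReal_nonneg, ENNReal.toReal_nonneg, ?_,
    fun x => ?_, fun x => ?_⟩
  · rw [← ENNReal.toReal_add hat hbt]
    exact (ENNReal.lt_ofReal_iff_toReal_lt hab).1 hm
  · rw [← Real.norm_eq_abs, ← toReal_enorm]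
    exact ENNReal.toReal_mono hat (le_iSup (fun x => ‖r₀ x - R₀ * Real.cosh (2 * x)‖ₑ) x)
  · rw [← Real.norm_eq_abs, ← toReal_enorm]
    exact ENNReal.toReal_mono hbt (le_iSup (fun x => ‖r₁ x - 2 * R₀ * Real.cosh (2 * x)‖ₑ) x)

/-- Twice d'Alembert's solution is at least `R₀ (exp (2u) + exp (2v)) - 2A - B (u + v)`, and `exp y
≥ 1 + y` bounds this below by `2 (R₀ - A) + (2 R₀ - B) (u + v)`. Both `A` and `B` are below `2 R₀ /
3`, which leaves room to spare. -/
theorem dAlembert_pos {R₀ : ℝ} (hR₀ : 0 < R₀) {r₀ r₁ : ℝ → ℝ} (hr₁ : Continuous r₁)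
    (hm : m₀ R₀ 0 r₀ r₁ < ENNReal.ofReal (2 * R₀ / 3)) {u v : ℝ} (huv : 0 ≤ u + v) :
    0 < (r₀ v + r₀ (-u) + ∫ s in -u..v, r₁ s) / 2 := by
  obtain ⟨A, B, hA0, hB0, hAB, hA, hB⟩ := exists_bounds_of_m₀_lt hm
  have hint : ∫ s in -u..v, (2 * R₀ * Real.cosh (2 * s) - B)
      = (R₀ * Real.sinh (2 * v) - B * v) - (R₀ * Real.sinh (2 * -u) - B * -u) := by
    refine intervalIntegral.integral_eq_sub_of_hasDerivAt
      (f := fun s => R₀ * Real.sinh (2 * s) - B * s) (fun s _ => ?_)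
      ((by fun_prop : Continuous fun s => 2 * R₀ * Real.cosh (2 * s) - B).intervalIntegrable _ _)
    refine ((((hasDerivAt_id s).const_mul 2).sinh.const_mul R₀).sub
      ((hasDerivAt_id s).const_mul B)).congr_deriv ?_
    simp only [id]
    ring
  have hle : ∫ s in -u..v, (2 * R₀ * Real.cosh (2 * s) - B) ≤ ∫ s in -u..v, r₁ s :=
    intervalIntegral.integral_mono_on (by linarith)
      ((by fun_prop : Continuous fun s => 2 * R₀ * Real.cosh (2 * s) - B).intervalIntegrable _ _)
      (hr₁.intervalIntegrable _ _) fun s _ => by linarith [(abs_le.1 (hB s)).1]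
  have h1 := (abs_le.1 (hA v)).1
  have h2 := (abs_le.1 (hA (-u))).1
  have h3 := Real.cosh_add_sinh (2 * v)
  have h4 := Real.cosh_add_sinh (2 * u)
  rw [hint, show 2 * -u = -(2 * u) by ring, Real.sinh_neg] at hle
  rw [show 2 * -u = -(2 * u) by ring, Real.cosh_neg] at h2
  have h5 := Real.add_one_le_exp (2 * v)
  have h6 := Real.add_one_le_exp (2 * u)
  have h7 : R₀ * (2 * (1 + (u + v))) ≤ R₀ * ((Real.cosh (2 * v) + Real.sinh (2 * v))
      + (Real.cosh (2 * u) + Real.sinh (2 * u))) :=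
    mul_le_mul_of_nonneg_left (by linarith) hR₀.le
  have h8 : B * (u + v) ≤ 2 * R₀ / 3 * (u + v) :=
    mul_le_mul_of_nonneg_right (by linarith) huv
  nlinarith [mul_nonneg hR₀.le huv]

/-- A function which is positive on the closed half-plane `u + v ≥ 0` agrees there with a function
which is positive everywhere. -/
theorem exists_positive_extension {F : ℝ → ℝ → ℝ}
    (hF : ContDiff ℝ 2 fun p : ℝ × ℝ => F p.1 p.2) (hpos : ∀ u v, 0 ≤ u + v → 0 < F u v) :
    ∃ G : ℝ → ℝ → ℝ, (ContDiff ℝ 2 fun p : ℝ × ℝ => G p.1 p.2) ∧ (∀ u v, 0 < G u v) ∧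
      ∀ u v, 0 ≤ u + v → G u v = F u v := by
  obtain ⟨φ, h0, h1, h01⟩ := exists_contMDiffMap_zero_one_of_isClosed (n := 2) 𝓘(ℝ, ℝ × ℝ)
    (s := {p : ℝ × ℝ | F p.1 p.2 ≤ 0}) (t := {p : ℝ × ℝ | 0 ≤ p.1 + p.2})
    (isClosed_le hF.continuous continuous_const)
    (isClosed_le continuous_const (continuous_fst.add continuous_snd))
    (Set.disjoint_left.2 fun p hp hp' => (hpos p.1 p.2 hp').not_ge hp)
  have cφ : ContDiff ℝ 2 φ := φ.contMDiff.contDiff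
  -- The cutoff `φ` vanishes where `F ≤ 0` and equals one on the half-plane. Where `F > 0` the value
  -- is a convex combination of `F` and `1`.
  refine ⟨fun u v => φ (u, v) * F u v + (1 - φ (u, v)),
    (cφ.mul hF).add (contDiff_const.sub cφ), fun u v => ?_, fun u v huv => ?_⟩
  · rcases le_or_gt (F u v) 0 with h | h
    · have : φ (u, v) = 0 := h0 h
      simp [this]
    · obtain ⟨ha, hb⟩ := h01 (u, v)
      rcases ha.eq_or_lt with h' | h'
      · simp [← h']
      · have := mul_pos h' h
        linarith
  · have : φ (u, v) = 1 := h1 huv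
    simp [this]

theorem exists_solution {R₀ : ℝ} (hR₀ : 0 < R₀) {r₀ r₁ w₀ w₁ q₀ q₁ : ℝ → ℝ}
    (hr₀ : ContDiff ℝ 2 r₀) (hw₀ : ContDiff ℝ 2 w₀) (hq₀ : ContDiff ℝ 2 q₀)
    (hr₁ : ContDiff ℝ 1 r₁) (hw₁ : ContDiff ℝ 1 w₁) (hq₁ : ContDiff ℝ 1 q₁)
    (hm : m₀ R₀ 0 r₀ r₁ < ENNReal.ofReal (2 * R₀ / 3)) :
    ∃ R W q : ℝ → ℝ → ℝ, (IsSolution R W q ∧ HasData R r₀ r₁ ∧ HasData W w₀ w₁ ∧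
      HasData q q₀ q₁) ∧ ∀ t, 0 ≤ t → ∀ x, 0 < R t x := by
  obtain ⟨F, Fu, Fv, cF, hFu, hFv, cFu, cFv, hFuv, hFvu, hF0, hF1, hFeq⟩ :=
    exists_dAlembert hr₀ hr₁
  have hFpos : ∀ u v, 0 ≤ u + v → 0 < F u v := fun u v huv => by
    rw [hFeq]
    exact dAlembert_pos hR₀ hr₁.continuous hm huv
  -- The frame system is solved on the whole plane, where `F` may vanish. Its coefficients are
  -- therefore built from `G`, which need not solve the wave equation; `F` remains the solution and
  -- agrees with `G` for `t ≥ 0`.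
  obtain ⟨G, cG, hGpos, hGF⟩ := exists_positive_extension cF hFpos
  obtain ⟨Gu, Gv, hGu, hGv, cGu, cGv⟩ := exists_partials (n := 1) cG
  obtain ⟨W, Wu, Wv, q, qu, qv, cW, cq, hWu, hWv, hqu, hqv, hWvu, hqvu, hWuv, hquv, cWu, cWv, cqu,
    cqv, hW0, hW1, hq0, hq1⟩ := exists_null_solution hGpos (cG.of_le (by norm_num)) hGu hGv cGu cGv
      hw₀ hq₀ hw₁ hq₁
  have hRG : ∀ t, 0 ≤ t → ∀ x, ofNull F t x = ofNull G t x := fun t ht x =>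
    (hGF _ _ (by linarith)).symm
  have hRt : ∀ t, 0 ≤ t → ∀ x, dt (ofNull F) t x = ofNull (fun u v => Gu u v + Gv u v) t x :=
    fun t ht x => (dt_congr hRG t ht x).trans
      (dt_ofNull hGu hGv cGu.continuous cGv.continuous ht x)
  have hRx : ∀ t, 0 ≤ t → ∀ x, dx (ofNull F) t x = ofNull (fun u v => Gv u v - Gu u v) t x :=
    fun t ht x => (dx_congr hRG t ht x).trans
      (dx_ofNull hGu hGv cGu.continuous cGv.continuous t x)
  refine ⟨ofNull F, ofNull W, ofNull q, ⟨⟨(contDiff_ofNull cF).contDiffOn,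
    (contDiff_ofNull cW).contDiffOn, (contDiff_ofNull cq).contDiffOn, fun t ht x => ?_,
    fun t ht x => ?_, fun t ht x => ?_⟩,
    hasData_ofNull hFu hFv cFu.continuous cFv.continuous hF0 hF1,
    hasData_ofNull hWu hWv cWu.continuous cWv.continuous hW0 hW1,
    hasData_ofNull hqu hqv cqu.continuous cqv.continuous hq0 hq1⟩,
    fun t ht x => hFpos _ _ (by linarith)⟩
  · have := wave_ofNull (h := fun _ _ => 0) hFu hFv cFu cFv hFuv hFvu ht x
    simp only [ofNull, mul_zero] at this ⊢
    linarith
  · rw [wave_ofNull hWu hWv cWu cWv hWuv hWvu ht x, hRt t ht, hRx t ht, hRG t ht,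
      dt_ofNull hWu hWv cWu.continuous cWv.continuous ht,
      dx_ofNull hWu hWv cWu.continuous cWv.continuous,
      dt_ofNull hqu hqv cqu.continuous cqv.continuous ht,
      dx_ofNull hqu hqv cqu.continuous cqv.continuous]
    have := (hGpos (t - x) (t + x)).ne'
    simp only [ofNull]
    field_simp
    ring
  · rw [wave_ofNull hqu hqv cqu cqv hquv hqvu ht x, hRt t ht, hRx t ht, hRG t ht,
      dt_ofNull hWu hWv cWu.continuous cWv.continuous ht,
      dx_ofNull hWu hWv cWu.continuous cWv.continuous,
      dt_ofNull hqu hqv cqu.continuous cqv.continuous ht,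
      dx_ofNull hqu hqv cqu.continuous cqv.continuous]
    have := (hGpos (t - x) (t + x)).ne'
    simp only [ofNull]
    field_simp
    ring

end Existence

/-! ### Uniqueness for transport systems in the future half-plane -/

section Uniqueness

/-- Solutions are differentiated in null directions only for `t > 0`, so no derivative is assumed at
the endpoints. The mean value inequality is applied on `[c, b]` and `c` tends to `a` by continuity.
-/
theorem norm_sub_le_of_norm_deriv_le_of_Ioo {E : Type*} [NormedAddCommGroup E] [NormedSpace ℝ E]
    {f f' : ℝ → E} {B B' : ℝ → ℝ} {a b : ℝ} (hab : a ≤ b) (hf : ContinuousOn f (Icc a b))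
    (hf' : ∀ s ∈ Ioo a b, HasDerivAt f (f' s) s) (hB : ∀ s, HasDerivAt B (B' s) s)
    (h : ∀ s ∈ Ioo a b, ‖f' s‖ ≤ B' s) : ‖f b - f a‖ ≤ B b - B a := by
  have hBc : Continuous B := continuous_iff_continuousAt.2 fun s => (hB s).continuousAt
  have h1 : ∀ c ∈ Ioo a b, ‖f b - f c‖ ≤ B b - B c := by
    intro c hc
    have hIco : ∀ s ∈ Ico c b, s ∈ Ioo a b := fun s hs => ⟨hc.1.trans_le hs.1, hs.2⟩
    exact image_norm_le_of_norm_deriv_right_le_deriv_boundary (f := fun s => f s - f c)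
      (f' := f') (B := fun s => B s - B c) (B' := B')
      ((hf.mono (Icc_subset_Icc_left hc.1.le)).sub continuousOn_const)
      (fun s hs => ((hf' s (hIco s hs)).sub_const _).hasDerivWithinAt)
      (by simp) (fun s => (hB s).sub_const _) (fun s hs => h s (hIco s hs))
      (right_mem_Icc.2 hc.2.le)
  rcases hab.eq_or_lt with rfl | hlt
  · simp
  · have ht : Tendsto f (𝓝[Ioo a b] a) (𝓝 (f a)) :=
      (hf a (left_mem_Icc.2 hab)).mono Ioo_subset_Icc_self
    have : (𝓝[Ioo a b] a).NeBot := by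
      rw [nhdsWithin_Ioo_eq_nhdsGT hlt]; infer_instance
    exact le_of_tendsto_of_tendsto (tendsto_const_nhds.sub ht).norm
      (tendsto_const_nhds.sub (hBc.continuousAt.tendsto.mono_left nhdsWithin_le_nhds))
      (eventually_mem_nhdsWithin.mono h1)

theorem isCompact_triangle (X : ℝ) :
    IsCompact {p : ℝ × ℝ | p.1 ≤ X ∧ p.2 ≤ X ∧ 0 ≤ p.1 + p.2} := by
  refine ((isCompact_Icc (a := -X) (b := X)).prod (isCompact_Icc (a := -X) (b := X)))
    |>.of_isClosed_subset ?_ ?_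
  · exact (isClosed_le continuous_fst continuous_const).inter
      ((isClosed_le continuous_snd continuous_const).inter
        (isClosed_le continuous_const (continuous_fst.add continuous_snd)))
  · rintro ⟨a, b⟩ ⟨ha, hb, hab⟩
    simp only [mem_prod, mem_Icc] at *
    exact ⟨⟨by linarith, ha⟩, by linarith, hb⟩

/-- Uniqueness for a system of transport equations `Y_u = Y'`, `Z_v = Z'` in the region
`u + v ≥ 0` with zero data on `u + v = 0`. -/
theorem eq_zero_of_transport_system {E G : Type*} [NormedAddCommGroup E] [NormedSpace ℝ E]
    [NormedAddCommGroup G] [NormedSpace ℝ G] {Y Y' : ℝ → ℝ → E} {Z Z' : ℝ → ℝ → G} {X K : ℝ}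
    (cY : ContinuousOn (fun p : ℝ × ℝ => Y p.1 p.2) {p | 0 ≤ p.1 + p.2})
    (cZ : ContinuousOn (fun p : ℝ × ℝ => Z p.1 p.2) {p | 0 ≤ p.1 + p.2})
    (hY0 : ∀ v, Y (-v) v = 0) (hZ0 : ∀ v, Z (-v) v = 0)
    (hY : ∀ u v, 0 < u + v → HasDerivAt (fun s => Y s v) (Y' u v) u)
    (hZ : ∀ u v, 0 < u + v → HasDerivAt (fun s => Z u s) (Z' u v) v)
    (hY' : ∀ u v, u ≤ X → v ≤ X → 0 < u + v → ‖Y' u v‖ ≤ K * max ‖Y u v‖ ‖Z u v‖)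
    (hZ' : ∀ u v, u ≤ X → v ≤ X → 0 < u + v → ‖Z' u v‖ ≤ K * max ‖Y u v‖ ‖Z u v‖)
    {u v : ℝ} (hu : u ≤ X) (hv : v ≤ X) (huv : 0 ≤ u + v) : Y u v = 0 ∧ Z u v = 0 := by
  obtain ⟨C, hC⟩ := (isCompact_triangle X).exists_bound_of_continuousOn
    (f := fun p : ℝ × ℝ => (Y p.1 p.2, Z p.1 p.2)) ((cY.prodMk cZ).mono fun p hp => hp.2.2)
  -- With this weight, integrating the differential inequality along a characteristic halves any
  -- admissible constant `ε`. The triangle contains every characteristic from its points back to the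
  -- initial line, so the step can be iterated from the compactness bound `C`.
  set μ := 2 * max K 0 + 1 with hμ
  have hμ0 : 0 < μ := by positivity
  have hK0 : 0 ≤ max K 0 := le_max_right _ _
  have step : ∀ ε : ℝ, 0 ≤ ε →
      (∀ a b, a ≤ X → b ≤ X → 0 ≤ a + b →
        max ‖Y a b‖ ‖Z a b‖ ≤ ε * Real.exp (μ * (a + b))) →
      ∀ a b, a ≤ X → b ≤ X → 0 ≤ a + b →
        max ‖Y a b‖ ‖Z a b‖ ≤ ε / 2 * Real.exp (μ * (a + b)) := by
    intro ε hε h a b ha hb hab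
    have hKμ : max K 0 * ε / μ ≤ ε / 2 := by
      rw [div_le_div_iff₀ hμ0 two_pos]
      nlinarith
    have hB : ∀ c s, HasDerivAt (fun s => max K 0 * ε / μ * Real.exp (μ * (c + s)))
        (max K 0 * (ε * Real.exp (μ * (c + s)))) s := fun c s => by
      refine ((((hasDerivAt_id s).const_add c).const_mul μ).exp.const_mul
        (max K 0 * ε / μ)).congr_deriv ?_
      simp only [id]
      field_simp
    have hbd : ∀ c d, c ≤ X → d ≤ X → 0 < c + d →
        K * max ‖Y c d‖ ‖Z c d‖ ≤ max K 0 * (ε * Real.exp (μ * (c + d))) :=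
      fun c d hc hd hcd => mul_le_mul (le_max_left _ _) (h c d hc hd hcd.le)
        (le_max_of_le_left (norm_nonneg _)) hK0
    have hfin : ∀ c : ℝ, max K 0 * ε / μ * Real.exp (μ * (a + b))
        - max K 0 * ε / μ * Real.exp (μ * c) ≤ ε / 2 * Real.exp (μ * (a + b)) := fun c => by
      have : 0 ≤ max K 0 * ε / μ * Real.exp (μ * c) := by positivity
      have := mul_le_mul_of_nonneg_right hKμ (Real.exp_nonneg (μ * (a + b)))
      linarith
    refine max_le ?_ ?_
    · have := norm_sub_le_of_norm_deriv_le_of_Ioo (f := fun s => Y s b) (f' := fun s => Y' s b)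
        (a := -b) (b := a) (by linarith)
        (cY.comp (f := fun s : ℝ => ((s, b) : ℝ × ℝ)) (by fun_prop) fun s hs => by
          have := hs.1
          simp only [mem_ofPred_eq]; linarith)
        (fun s hs => hY s b (by linarith [hs.1])) (hB b)
        (fun s hs => (hY' s b (by linarith [hs.2]) hb (by linarith [hs.1])).trans (by
          rw [add_comm b s]
          exact hbd s b (by linarith [hs.2]) hb (by linarith [hs.1])))
      rw [hY0, sub_zero, add_comm b a] at this
      exact this.trans (hfin _)
    · have := norm_sub_le_of_norm_deriv_le_of_Ioo (f := fun s => Z a s) (f' := fun s => Z' a s)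
        (a := -a) (b := b) (by linarith)
        (cZ.comp (f := fun s : ℝ => ((a, s) : ℝ × ℝ)) (by fun_prop) fun s hs => by
          have := hs.1
          simp only [mem_ofPred_eq]; linarith)
        (fun s hs => hZ a s (by linarith [hs.1])) (hB a)
        (fun s hs => (hZ' a s ha (by linarith [hs.2]) (by linarith [hs.1])).trans
          (hbd a s ha (by linarith [hs.2]) (by linarith [hs.1])))
      have hZ0' : Z a (-a) = 0 := by simpa using hZ0 (-a)
      rw [hZ0', sub_zero] at this
      exact this.trans (hfin _)
  have hiter : ∀ n : ℕ, ∀ a b, a ≤ X → b ≤ X → 0 ≤ a + b →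
      max ‖Y a b‖ ‖Z a b‖ ≤ max C 0 / 2 ^ n * Real.exp (μ * (a + b)) := fun n => by
    induction n with
    | zero =>
      intro a b ha hb hab
      rw [pow_zero, div_one]
      exact ((hC (a, b) ⟨ha, hb, hab⟩).trans (le_max_left C 0)).trans
        (le_mul_of_one_le_right (le_max_right _ _) (Real.one_le_exp (by positivity)))
    | succ n ih =>
      have := step _ (by positivity) ih
      rwa [div_div, ← pow_succ] at this
  have hlim : Tendsto (fun n : ℕ => max C 0 / 2 ^ n * Real.exp (μ * (u + v))) atTop (𝓝 0) := by
    have := ((tendsto_pow_atTop_nhds_zero_of_lt_one (r := (1 / 2 : ℝ)) (by norm_num)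
      (by norm_num)).const_mul (max C 0)).mul_const (Real.exp (μ * (u + v)))
    simpa [div_eq_mul_inv] using this
  have h0 := ge_of_tendsto' hlim fun n => hiter n u v hu hv huv
  exact ⟨norm_le_zero_iff.1 ((le_max_left _ _).trans h0),
    norm_le_zero_iff.1 ((le_max_right _ _).trans h0)⟩

/-! ### One-sided derivatives and the passage to null coordinates -/

theorem uniqueDiffOn_future : UniqueDiffOn ℝ future :=
  (uniqueDiffOn_Ici 0).prod uniqueDiffOn_univ

theorem dt_eq_fderivWithin {f : ℝ → ℝ → ℝ}
    (hf : ContDiffOn ℝ 2 (fun p : ℝ × ℝ => f p.1 p.2) future) {t : ℝ} (ht : 0 ≤ t) (x : ℝ) :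
    dt f t x = fderivWithin ℝ (fun p : ℝ × ℝ => f p.1 p.2) future (t, x) (1, 0) := by
  have h := (hf.differentiableOn (by norm_num) (t, x) ⟨ht, mem_univ x⟩).hasFDerivWithinAt
  have h2 := h.comp_hasDerivWithinAt (f := fun s => ((s, x) : ℝ × ℝ)) (s := Ici 0) t
    ((hasDerivAt_id t).prodMk (hasDerivAt_const t x)).hasDerivWithinAt
    fun s hs => ⟨hs, mem_univ x⟩
  exact h2.derivWithin (uniqueDiffOn_Ici 0 t ht)

theorem dx_eq_fderivWithin {f : ℝ → ℝ → ℝ}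
    (hf : ContDiffOn ℝ 2 (fun p : ℝ × ℝ => f p.1 p.2) future) {t : ℝ} (ht : 0 ≤ t) (x : ℝ) :
    dx f t x = fderivWithin ℝ (fun p : ℝ × ℝ => f p.1 p.2) future (t, x) (0, 1) := by
  have h := (hf.differentiableOn (by norm_num) (t, x) ⟨ht, mem_univ x⟩).hasFDerivWithinAt
  have h2 := h.comp_hasDerivWithinAt (f := fun s => ((t, s) : ℝ × ℝ)) (s := univ) x
    ((hasDerivAt_const x t).prodMk (hasDerivAt_id x)).hasDerivWithinAt
    fun s _ => ⟨ht, mem_univ s⟩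
  exact (hasDerivWithinAt_univ.1 h2).deriv

theorem continuousOn_dt {f : ℝ → ℝ → ℝ}
    (hf : ContDiffOn ℝ 2 (fun p : ℝ × ℝ => f p.1 p.2) future) :
    ContinuousOn (fun p : ℝ × ℝ => dt f p.1 p.2) future :=
  ((hf.continuousOn_fderivWithin uniqueDiffOn_future (by norm_num)).clm_apply
    continuousOn_const).congr fun p hp => dt_eq_fderivWithin hf hp.1 p.2

theorem continuousOn_dx {f : ℝ → ℝ → ℝ}
    (hf : ContDiffOn ℝ 2 (fun p : ℝ × ℝ => f p.1 p.2) future) :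
    ContinuousOn (fun p : ℝ × ℝ => dx f p.1 p.2) future :=
  ((hf.continuousOn_fderivWithin uniqueDiffOn_future (by norm_num)).clm_apply
    continuousOn_const).congr fun p hp => dx_eq_fderivWithin hf hp.1 p.2

theorem future_mem_nhds {t : ℝ} (ht : 0 < t) (x : ℝ) : future ∈ 𝓝 (t, x) :=
  prod_mem_nhds (Ici_mem_nhds ht) univ_mem

/-- First and second derivatives of a `C²` function in the open half-plane `t > 0`. -/
theorem exists_second_fderiv {f : ℝ → ℝ → ℝ}
    (hf : ContDiffOn ℝ 2 (fun p : ℝ × ℝ => f p.1 p.2) future) {t : ℝ} (ht : 0 < t) (x : ℝ) :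
    HasFDerivAt (fun p : ℝ × ℝ => f p.1 p.2) (dt f t x • ContinuousLinearMap.fst ℝ ℝ ℝ
      + dx f t x • ContinuousLinearMap.snd ℝ ℝ ℝ) (t, x) ∧
    ∃ a b c : ℝ,
      HasFDerivAt (fun p : ℝ × ℝ => dt f p.1 p.2) (a • ContinuousLinearMap.fst ℝ ℝ ℝ
        + b • ContinuousLinearMap.snd ℝ ℝ ℝ) (t, x) ∧
      HasFDerivAt (fun p : ℝ × ℝ => dx f p.1 p.2) (b • ContinuousLinearMap.fst ℝ ℝ ℝ
        + c • ContinuousLinearMap.snd ℝ ℝ ℝ) (t, x) ∧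
      dt (dt f) t x = a ∧ dx (dx f) t x = c := by
  set F : ℝ × ℝ → ℝ := fun p => f p.1 p.2 with hF
  have hext : ∀ (L : ℝ × ℝ →L[ℝ] ℝ), L = L (1, 0) • ContinuousLinearMap.fst ℝ ℝ ℝ
      + L (0, 1) • ContinuousLinearMap.snd ℝ ℝ ℝ := fun L => by
    ext <;> simp
  have hev : ∀ᶠ p in 𝓝 (t, x), 0 < p.1 := by
    exact continuous_fst.continuousAt.eventually_const_lt ht
  have hfd : ∀ p : ℝ × ℝ, 0 < p.1 → fderivWithin ℝ F future p = fderiv ℝ F p := fun p hp =>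
    fderivWithin_of_mem_nhds (future_mem_nhds hp p.2)
  have hdt : ∀ᶠ p : ℝ × ℝ in 𝓝 (t, x), dt f p.1 p.2 = fderiv ℝ F p (1, 0) := by
    filter_upwards [hev] with p hp
    rw [dt_eq_fderivWithin hf hp.le, hfd p hp]
  have hdx : ∀ᶠ p : ℝ × ℝ in 𝓝 (t, x), dx f p.1 p.2 = fderiv ℝ F p (0, 1) := by
    filter_upwards [hev] with p hp
    rw [dx_eq_fderivWithin hf hp.le, hfd p hp]
  have hc : ContDiffAt ℝ 2 F (t, x) := hf.contDiffAt (future_mem_nhds ht x)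
  have h1 : HasFDerivAt F (fderiv ℝ F (t, x)) (t, x) :=
    (hc.differentiableAt (by norm_num)).hasFDerivAt
  have h2 : HasFDerivAt (fderiv ℝ F) (fderiv ℝ (fderiv ℝ F) (t, x)) (t, x) :=
    ((hc.fderiv_right (m := 1) (by norm_num)).differentiableAt (by norm_num)).hasFDerivAt
  have hsymm := hc.isSymmSndFDerivAt (by simp)
  set D := fderiv ℝ (fderiv ℝ F) (t, x) with hD
  have hDt : HasFDerivAt (fun p : ℝ × ℝ => dt f p.1 p.2)
      (D (1, 0) (1, 0) • ContinuousLinearMap.fst ℝ ℝ ℝ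
        + D (1, 0) (0, 1) • ContinuousLinearMap.snd ℝ ℝ ℝ) (t, x) := by
    have h3 := (h2.clm_apply (hasFDerivAt_const ((1, 0) : ℝ × ℝ) (t, x))).congr_of_eventuallyEq hdt
    refine h3.congr_fderiv ((hext _).trans ?_)
    have := hsymm.eq (1, 0) (0, 1)
    simp [← hD] at this ⊢
    rw [this]
  have hDx : HasFDerivAt (fun p : ℝ × ℝ => dx f p.1 p.2)
      (D (1, 0) (0, 1) • ContinuousLinearMap.fst ℝ ℝ ℝ
        + D (0, 1) (0, 1) • ContinuousLinearMap.snd ℝ ℝ ℝ) (t, x) := by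
    have h3 := (h2.clm_apply (hasFDerivAt_const ((0, 1) : ℝ × ℝ) (t, x))).congr_of_eventuallyEq hdx
    refine h3.congr_fderiv ((hext _).trans ?_)
    simp
  refine ⟨?_, _, _, _, hDt, hDx, ?_, ?_⟩
  · refine h1.congr_fderiv ((hext _).trans ?_)
    rw [hdt.self_of_nhds, hdx.self_of_nhds]
  · have h4 := hDt.comp_hasDerivAt (f := fun s => ((s, x) : ℝ × ℝ)) t
      ((hasDerivAt_id t).prodMk (hasDerivAt_const t x))
    refine (h4.hasDerivWithinAt.derivWithin (uniqueDiffOn_Ici 0 t ht.le)).trans ?_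
    simp
  · have h4 := hDx.comp_hasDerivAt (f := fun s => ((t, s) : ℝ × ℝ)) x
      ((hasDerivAt_const x t).prodMk (hasDerivAt_id x))
    refine h4.deriv.trans ?_
    simp

/-- The function `f (t, x)` in the null coordinates `u = t - x`, `v = t + x`. -/
noncomputable def toNull (f : ℝ → ℝ → ℝ) (u v : ℝ) : ℝ := f ((u + v) / 2) ((v - u) / 2)

/-- The derivative `f_u` in null coordinates. -/
noncomputable def nullU (f : ℝ → ℝ → ℝ) : ℝ → ℝ → ℝ := toNull fun t x => (dt f t x - dx f t x) / 2

/-- The derivative `f_v` in null coordinates. -/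
noncomputable def nullV (f : ℝ → ℝ → ℝ) : ℝ → ℝ → ℝ := toNull fun t x => (dt f t x + dx f t x) / 2

/-- The mixed derivative `f_{uv}` in null coordinates. -/
noncomputable def nullUV (f : ℝ → ℝ → ℝ) : ℝ → ℝ → ℝ :=
  toNull fun t x => (dt (dt f) t x - dx (dx f) t x) / 4

theorem continuousOn_toNull {f : ℝ → ℝ → ℝ}
    (hf : ContinuousOn (fun p : ℝ × ℝ => f p.1 p.2) future) :
    ContinuousOn (fun p : ℝ × ℝ => toNull f p.1 p.2) {p | 0 ≤ p.1 + p.2} :=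
  hf.comp (f := fun p : ℝ × ℝ => (((p.1 + p.2) / 2, (p.2 - p.1) / 2) : ℝ × ℝ))
    (by fun_prop) fun p hp => ⟨show 0 ≤ (p.1 + p.2) / 2 from div_nonneg hp zero_le_two, mem_univ _⟩

theorem hasDerivAt_toNull_left {f : ℝ → ℝ → ℝ} {a b u v : ℝ}
    (h : HasFDerivAt (fun p : ℝ × ℝ => f p.1 p.2) (a • ContinuousLinearMap.fst ℝ ℝ ℝ
      + b • ContinuousLinearMap.snd ℝ ℝ ℝ) ((u + v) / 2, (v - u) / 2)) :
    HasDerivAt (fun s => toNull f s v) ((a - b) / 2) u := by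
  have := h.comp_hasDerivAt (f := fun s => (((s + v) / 2, (v - s) / 2) : ℝ × ℝ)) u
    ((((hasDerivAt_id u).add_const v).div_const 2).prodMk
      (((hasDerivAt_id u).const_sub v).div_const 2))
  refine this.congr_deriv ?_
  simp
  ring

theorem hasDerivAt_toNull_right {f : ℝ → ℝ → ℝ} {a b u v : ℝ}
    (h : HasFDerivAt (fun p : ℝ × ℝ => f p.1 p.2) (a • ContinuousLinearMap.fst ℝ ℝ ℝ
      + b • ContinuousLinearMap.snd ℝ ℝ ℝ) ((u + v) / 2, (v - u) / 2)) :
    HasDerivAt (fun s => toNull f u s) ((a + b) / 2) v := by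
  have := h.comp_hasDerivAt (f := fun s => (((u + s) / 2, (s - u) / 2) : ℝ × ℝ)) v
    ((((hasDerivAt_id v).const_add u).div_const 2).prodMk
      (((hasDerivAt_id v).sub_const u).div_const 2))
  refine this.congr_deriv ?_
  simp
  ring

theorem continuousOn_nullU {f : ℝ → ℝ → ℝ}
    (hf : ContDiffOn ℝ 2 (fun p : ℝ × ℝ => f p.1 p.2) future) :
    ContinuousOn (fun p : ℝ × ℝ => nullU f p.1 p.2) {p | 0 ≤ p.1 + p.2} :=
  continuousOn_toNull (((continuousOn_dt hf).sub (continuousOn_dx hf)).div_const 2)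

theorem continuousOn_nullV {f : ℝ → ℝ → ℝ}
    (hf : ContDiffOn ℝ 2 (fun p : ℝ × ℝ => f p.1 p.2) future) :
    ContinuousOn (fun p : ℝ × ℝ => nullV f p.1 p.2) {p | 0 ≤ p.1 + p.2} :=
  continuousOn_toNull (((continuousOn_dt hf).add (continuousOn_dx hf)).div_const 2)

theorem hasDerivAt_toNull {f : ℝ → ℝ → ℝ}
    (hf : ContDiffOn ℝ 2 (fun p : ℝ × ℝ => f p.1 p.2) future) {u v : ℝ} (h : 0 < u + v) :
    HasDerivAt (fun s => toNull f s v) (nullU f u v) u :=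
  hasDerivAt_toNull_left (exists_second_fderiv hf (half_pos h) _).1

theorem hasDerivAt_nullU {f : ℝ → ℝ → ℝ}
    (hf : ContDiffOn ℝ 2 (fun p : ℝ × ℝ => f p.1 p.2) future) {u v : ℝ} (h : 0 < u + v) :
    HasDerivAt (fun s => nullU f u s) (nullUV f u v) v := by
  obtain ⟨-, a, b, c, h1, h2, h3, h4⟩ := exists_second_fderiv hf (half_pos h) ((v - u) / 2)
  refine ((hasDerivAt_toNull_right h1).sub (hasDerivAt_toNull_right h2)).div_const 2
    |>.congr_deriv ?_
  simp only [nullUV, toNull, h3, h4]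
  ring

theorem hasDerivAt_nullV {f : ℝ → ℝ → ℝ}
    (hf : ContDiffOn ℝ 2 (fun p : ℝ × ℝ => f p.1 p.2) future) {u v : ℝ} (h : 0 < u + v) :
    HasDerivAt (fun s => nullV f s v) (nullUV f u v) u := by
  obtain ⟨-, a, b, c, h1, h2, h3, h4⟩ := exists_second_fderiv hf (half_pos h) ((v - u) / 2)
  refine ((hasDerivAt_toNull_left h1).add (hasDerivAt_toNull_left h2)).div_const 2
    |>.congr_deriv ?_
  simp only [nullUV, toNull, h3, h4]
  ring

end Uniqueness

/-! ### Uniqueness of the solution -/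

section UniqueSolution

theorem HasData.dx_eq {f f' : ℝ → ℝ → ℝ} {f₀ f₁ : ℝ → ℝ} (h : HasData f f₀ f₁)
    (h' : HasData f' f₀ f₁) (x : ℝ) : dx f' 0 x = dx f 0 x := by
  have : f' 0 = f 0 := funext fun x => (h' x).1.trans (h x).1.symm
  simp only [dx, this]

theorem HasData.toNull_eq {f f' : ℝ → ℝ → ℝ} {f₀ f₁ : ℝ → ℝ} (h : HasData f f₀ f₁)
    (h' : HasData f' f₀ f₁) (v : ℝ) : toNull f' (-v) v = toNull f (-v) v := by
  simp only [toNull, neg_add_cancel, zero_div, (h _).1, (h' _).1]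

theorem HasData.nullU_eq {f f' : ℝ → ℝ → ℝ} {f₀ f₁ : ℝ → ℝ} (h : HasData f f₀ f₁)
    (h' : HasData f' f₀ f₁) (v : ℝ) : nullU f' (-v) v = nullU f (-v) v := by
  simp only [nullU, toNull, neg_add_cancel, zero_div, (h _).2, (h' _).2, h.dx_eq h']

theorem HasData.nullV_eq {f f' : ℝ → ℝ → ℝ} {f₀ f₁ : ℝ → ℝ} (h : HasData f f₀ f₁)
    (h' : HasData f' f₀ f₁) (v : ℝ) : nullV f' (-v) v = nullV f (-v) v := by
  simp only [nullV, toNull, neg_add_cancel, zero_div, (h _).2, (h' _).2, h.dx_eq h']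

/-- The right-hand side of the wave map equations in null coordinates, as a function of
`((R_v / 2R, R_u / 2R), (W, W_u, W_v, q_u, q_v))`. -/
noncomputable def nonlinearity (s : (ℝ × ℝ) × (ℝ × ℝ × ℝ × ℝ × ℝ)) : ℝ × ℝ :=
  (-(s.1.1 * s.2.2.1 + s.1.2 * s.2.2.2.1) - Real.exp (-4 * s.2.1) * s.2.2.2.2.1 * s.2.2.2.2.2 / 2,
    -(s.1.1 * s.2.2.2.2.1 + s.1.2 * s.2.2.2.2.2)
      + 2 * (s.2.2.2.2.2 * s.2.2.1 + s.2.2.2.2.1 * s.2.2.2.1))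

theorem contDiff_nonlinearity : ContDiff ℝ 1 nonlinearity := by
  refine ContDiff.prodMk ?_ ?_
  · exact ContDiff.sub (by fun_prop) (ContDiff.div_const (by fun_prop) _)
  · fun_prop

/-- The arguments of `nonlinearity` along a solution. -/
noncomputable def nullState (R W q : ℝ → ℝ → ℝ) (u v : ℝ) : (ℝ × ℝ) × (ℝ × ℝ × ℝ × ℝ × ℝ) :=
  ((nullV R u v / (2 * toNull R u v), nullU R u v / (2 * toNull R u v)),
    (toNull W u v, nullU W u v, nullV W u v, nullU q u v, nullV q u v))

variable {R W q R' W' q' : ℝ → ℝ → ℝ}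

theorem IsSolution.nullUV_R (h : IsSolution R W q) {u v : ℝ} (huv : 0 ≤ u + v) :
    nullUV R u v = 0 := by
  have := h.eq_R ((u + v) / 2) (by positivity) ((v - u) / 2)
  simp only [nullUV, toNull]
  linear_combination (-1 / 4) * this

theorem IsSolution.nullUV_eq (h : IsSolution R W q) {u v : ℝ} (huv : 0 ≤ u + v) :
    (nullUV W u v, nullUV q u v) = nonlinearity (nullState R W q u v) := by
  have hW := h.eq_W ((u + v) / 2) (by positivity) ((v - u) / 2)
  have hq := h.eq_q ((u + v) / 2) (by positivity) ((v - u) / 2)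
  refine Prod.ext ?_ ?_
  · simp only [nullUV, toNull, nonlinearity, nullState, nullU, nullV]
    linear_combination (1 / 4) * hW
  · simp only [nullUV, toNull, nonlinearity, nullState, nullU, nullV]
    linear_combination (1 / 4) * hq

theorem IsSolution.continuousOn_nullState (h : IsSolution R W q)
    (hpos : ∀ t, 0 ≤ t → ∀ x, 0 < R t x) :
    ContinuousOn (fun p : ℝ × ℝ => nullState R W q p.1 p.2) {p | 0 ≤ p.1 + p.2} := by
  have hR := continuousOn_toNull h.contDiffOn_R.continuousOn
  have h0 : ∀ p ∈ {p : ℝ × ℝ | 0 ≤ p.1 + p.2}, 2 * toNull R p.1 p.2 ≠ 0 := fun p hp => by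
    have := hpos ((p.1 + p.2) / 2) (div_nonneg hp zero_le_two) ((p.2 - p.1) / 2)
    simp only [toNull]
    positivity
  exact ((((continuousOn_nullV h.contDiffOn_R).div (continuousOn_const.mul hR) h0).prodMk
    ((continuousOn_nullU h.contDiffOn_R).div (continuousOn_const.mul hR) h0))).prodMk
    ((continuousOn_toNull h.contDiffOn_W.continuousOn).prodMk
    ((continuousOn_nullU h.contDiffOn_W).prodMk ((continuousOn_nullV h.contDiffOn_W).prodMk
    ((continuousOn_nullU h.contDiffOn_q).prodMk (continuousOn_nullV h.contDiffOn_q)))))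

/-- The equation for `R` is autonomous and linear, so no positivity is needed. The null derivatives
are compared together with `R` because they enter the coefficients of the other equations. -/
theorem IsSolution.unique_R (h : IsSolution R W q) (h' : IsSolution R' W' q') {r₀ r₁ : ℝ → ℝ}
    (hR : HasData R r₀ r₁) (hR' : HasData R' r₀ r₁) {u v : ℝ} (huv : 0 ≤ u + v) :
    toNull R' u v = toNull R u v ∧ nullU R' u v = nullU R u v ∧ nullV R' u v = nullV R u v := by
  have d := h.contDiffOn_R
  have d' := h'.contDiffOn_R
  obtain ⟨hY, hZ⟩ := eq_zero_of_transport_system (X := max u v) (K := 1)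
    (Y := fun u v => (toNull R' u v - toNull R u v, nullV R' u v - nullV R u v))
    (Z := fun u v => nullU R' u v - nullU R u v)
    (Y' := fun u v => (nullU R' u v - nullU R u v, nullUV R' u v - nullUV R u v))
    (Z' := fun u v => nullUV R' u v - nullUV R u v)
    (((continuousOn_toNull d'.continuousOn).sub (continuousOn_toNull d.continuousOn)).prodMk
      ((continuousOn_nullV d').sub (continuousOn_nullV d)))
    ((continuousOn_nullU d').sub (continuousOn_nullU d))
    (fun v => by simp [hR.toNull_eq hR', hR.nullV_eq hR'])
    (fun v => by simp [hR.nullU_eq hR'])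
    (fun u v huv => ((hasDerivAt_toNull d' huv).sub (hasDerivAt_toNull d huv)).prodMk
      ((hasDerivAt_nullV d' huv).sub (hasDerivAt_nullV d huv)))
    (fun u v huv => (hasDerivAt_nullU d' huv).sub (hasDerivAt_nullU d huv))
    (fun u v _ _ huv => by
      simp only [h.nullUV_R huv.le, h'.nullUV_R huv.le, sub_zero, one_mul]
      refine norm_prod_le_iff.2 ⟨le_max_right _ _, ?_⟩
      rw [norm_zero]
      exact le_max_of_le_left (norm_nonneg _))
    (fun u v _ _ huv => by
      simp only [h.nullUV_R huv.le, h'.nullUV_R huv.le, sub_zero, one_mul, norm_zero]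
      exact le_max_of_le_left (norm_nonneg _))
    (le_max_left u v) (le_max_right u v) huv
  exact ⟨sub_eq_zero.1 (congrArg Prod.fst hY), sub_eq_zero.1 hZ,
    sub_eq_zero.1 (congrArg Prod.snd hY)⟩

/-- Positivity of the competitor is not assumed: it is inherited once `R' = R` is known. Both states
are then bounded on a compact triangle, where the nonlinearity is Lipschitz. -/
theorem IsSolution.unique (h : IsSolution R W q) (h' : IsSolution R' W' q')
    {r₀ r₁ w₀ w₁ q₀ q₁ : ℝ → ℝ} (hpos : ∀ t, 0 ≤ t → ∀ x, 0 < R t x)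
    (hR : HasData R r₀ r₁) (hW : HasData W w₀ w₁) (hq : HasData q q₀ q₁)
    (hR' : HasData R' r₀ r₁) (hW' : HasData W' w₀ w₁) (hq' : HasData q' q₀ q₁) {t : ℝ}
    (ht : 0 ≤ t) (x : ℝ) : R' t x = R t x ∧ W' t x = W t x ∧ q' t x = q t x := by
  have hRR : ∀ u v, 0 ≤ u + v →
      toNull R' u v = toNull R u v ∧ nullU R' u v = nullU R u v ∧ nullV R' u v = nullV R u v :=
    fun u v huv => h.unique_R h' hR hR' huv
  have e1 : (t - x + (t + x)) / 2 = t := by ring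
  have e2 : (t + x - (t - x)) / 2 = x := by ring
  have hconv : ∀ f : ℝ → ℝ → ℝ, toNull f (t - x) (t + x) = f t x := fun f => by
    simp only [toNull, e1, e2]
  have hpos' : ∀ t, 0 ≤ t → ∀ x, 0 < R' t x := fun t ht x => by
    have e1 : (t - x + (t + x)) / 2 = t := by ring
    have e2 : (t + x - (t - x)) / 2 = x := by ring
    have := (hRR (t - x) (t + x) (by linarith)).1
    simp only [toNull, e1, e2] at this
    rw [this]
    exact hpos t ht x
  set X := max (t - x) (t + x)
  have hsub : {p : ℝ × ℝ | p.1 ≤ X ∧ p.2 ≤ X ∧ 0 ≤ p.1 + p.2} ⊆ {p | 0 ≤ p.1 + p.2} :=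
    fun p hp => hp.2.2
  obtain ⟨C, hC⟩ := (isCompact_triangle X).exists_bound_of_continuousOn
    ((h.continuousOn_nullState hpos).mono hsub)
  obtain ⟨C', hC'⟩ := (isCompact_triangle X).exists_bound_of_continuousOn
    ((h'.continuousOn_nullState hpos').mono hsub)
  obtain ⟨L, hL⟩ := (contDiff_nonlinearity.contDiffOn
    (s := Metric.closedBall 0 (max C C'))).exists_lipschitzOnWith one_ne_zero
    (convex_closedBall _ _) (isCompact_closedBall _ _)
  have d := h.contDiffOn_W
  have d' := h'.contDiffOn_W
  have k := h.contDiffOn_q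
  have k' := h'.contDiffOn_q
  set Y : ℝ → ℝ → ℝ × ℝ × ℝ × ℝ := fun u v =>
    (toNull W' u v - toNull W u v, nullV W' u v - nullV W u v, toNull q' u v - toNull q u v,
      nullV q' u v - nullV q u v) with hYdef
  set Z : ℝ → ℝ → ℝ × ℝ := fun u v =>
    (nullU W' u v - nullU W u v, nullU q' u v - nullU q u v) with hZdef
  have hYn : ∀ u v, |toNull W' u v - toNull W u v| ≤ ‖Y u v‖ ∧
      |nullV W' u v - nullV W u v| ≤ ‖Y u v‖ ∧ |nullV q' u v - nullV q u v| ≤ ‖Y u v‖ :=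
    fun u v => by simp [hYdef, Prod.norm_def]
  have hZn : ∀ u v, |nullU W' u v - nullU W u v| ≤ ‖Z u v‖ ∧
      |nullU q' u v - nullU q u v| ≤ ‖Z u v‖ := fun u v => by simp [hZdef, Prod.norm_def]
  have hlip : ∀ u v, u ≤ X → v ≤ X → 0 < u + v →
      ‖(nullUV W' u v - nullUV W u v, nullUV q' u v - nullUV q u v)‖
        ≤ max (L : ℝ) 1 * max ‖Y u v‖ ‖Z u v‖ := fun u v hu hv huv => by
    have h1 := hL.norm_sub_le
      (mem_closedBall_zero_iff.2 ((hC' (u, v) ⟨hu, hv, huv.le⟩).trans (le_max_right C C')))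
      (mem_closedBall_zero_iff.2 ((hC (u, v) ⟨hu, hv, huv.le⟩).trans (le_max_left C C')))
    rw [← h.nullUV_eq huv.le, ← h'.nullUV_eq huv.le, Prod.mk_sub_mk] at h1
    refine h1.trans (mul_le_mul (le_max_left _ _) ?_ (norm_nonneg _) (by positivity))
    obtain ⟨a1, a2, a3⟩ := hRR u v huv.le
    obtain ⟨b1, b2, b3⟩ := hYn u v
    obtain ⟨c1, c2⟩ := hZn u v
    -- The coefficients built from `R` coincide for both solutions and drop out of the difference of
    -- states.
    simp only [nullState, a1, a2, a3, Prod.mk_sub_mk, sub_self]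
    refine norm_prod_le_iff.2 ⟨?_, norm_prod_le_iff.2 ⟨le_max_of_le_left b1,
      norm_prod_le_iff.2 ⟨le_max_of_le_right c1, norm_prod_le_iff.2 ⟨le_max_of_le_left b2,
      norm_prod_le_iff.2 ⟨le_max_of_le_right c2, le_max_of_le_left b3⟩⟩⟩⟩⟩
    simp
  -- The constant is `max L 1`: the second derivatives cost the Lipschitz constant `L`, while the
  -- `u`-derivatives of the differences of `W` and `q` are entries of `Z` and cost `1`.
  obtain ⟨hY, -⟩ := eq_zero_of_transport_system (X := X) (K := max (L : ℝ) 1) (Y := Y) (Z := Z)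
    (Y' := fun u v => (nullU W' u v - nullU W u v, nullUV W' u v - nullUV W u v,
      nullU q' u v - nullU q u v, nullUV q' u v - nullUV q u v))
    (Z' := fun u v => (nullUV W' u v - nullUV W u v, nullUV q' u v - nullUV q u v))
    (((continuousOn_toNull d'.continuousOn).sub (continuousOn_toNull d.continuousOn)).prodMk
      (((continuousOn_nullV d').sub (continuousOn_nullV d)).prodMk
      (((continuousOn_toNull k'.continuousOn).sub (continuousOn_toNull k.continuousOn)).prodMk
      ((continuousOn_nullV k').sub (continuousOn_nullV k)))))
    (((continuousOn_nullU d').sub (continuousOn_nullU d)).prodMk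
      ((continuousOn_nullU k').sub (continuousOn_nullU k)))
    (fun v => by simp [hYdef, hW.toNull_eq hW', hW.nullV_eq hW', hq.toNull_eq hq',
      hq.nullV_eq hq'])
    (fun v => by simp [hZdef, hW.nullU_eq hW', hq.nullU_eq hq'])
    (fun u v huv => ((hasDerivAt_toNull d' huv).sub (hasDerivAt_toNull d huv)).prodMk
      (((hasDerivAt_nullV d' huv).sub (hasDerivAt_nullV d huv)).prodMk
      (((hasDerivAt_toNull k' huv).sub (hasDerivAt_toNull k huv)).prodMk
      ((hasDerivAt_nullV k' huv).sub (hasDerivAt_nullV k huv)))))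
    (fun u v huv => ((hasDerivAt_nullU d' huv).sub (hasDerivAt_nullU d huv)).prodMk
      ((hasDerivAt_nullU k' huv).sub (hasDerivAt_nullU k huv)))
    (fun u v hu hv huv => by
      have hl := norm_prod_le_iff.1 (hlip u v hu hv huv)
      have hm : max ‖Y u v‖ ‖Z u v‖ ≤ max (L : ℝ) 1 * max ‖Y u v‖ ‖Z u v‖ :=
        le_mul_of_one_le_left (le_max_of_le_left (norm_nonneg _)) (le_max_right _ _)
      obtain ⟨c1, c2⟩ := hZn u v
      exact norm_prod_le_iff.2 ⟨(le_max_of_le_right c1).trans hm, norm_prod_le_iff.2 ⟨hl.1,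
        norm_prod_le_iff.2 ⟨(le_max_of_le_right c2).trans hm, hl.2⟩⟩⟩)
    hlip (le_max_left (t - x) (t + x)) (le_max_right (t - x) (t + x)) (by linarith)
  have hY1 := sub_eq_zero.1 (congrArg Prod.fst hY)
  have hY3 := sub_eq_zero.1 (congrArg (fun y => y.2.2.1) hY)
  have hR1 := (hRR (t - x) (t + x) (by linarith)).1
  rw [hconv, hconv] at hY1 hY3 hR1
  exact ⟨hR1, hY1, hY3⟩

end UniqueSolution

end DoubleCusp

theorem mainTheorem2
    (R₀ : ℝ) (hR₀ : 0 < R₀)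
    (r₀ r₁ w₀ w₁ q₀ q₁ : ℝ → ℝ)
    (hr₀ : ContDiff ℝ 2 r₀) (hw₀ : ContDiff ℝ 2 w₀) (hq₀ : ContDiff ℝ 2 q₀)
    (hr₁ : ContDiff ℝ 1 r₁) (hw₁ : ContDiff ℝ 1 w₁) (hq₁ : ContDiff ℝ 1 q₁)
    (hm : DoubleCusp.m₀ R₀ 0 r₀ r₁ < ENNReal.ofReal (2 * R₀ / 3)) :
    ∃ R W q : ℝ → ℝ → ℝ,
      (DoubleCusp.IsSolution R W q ∧ DoubleCusp.HasData R r₀ r₁ ∧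
        DoubleCusp.HasData W w₀ w₁ ∧ DoubleCusp.HasData q q₀ q₁) ∧
      (∀ t, 0 ≤ t → ∀ x, 0 < R t x) ∧
      ∀ R' W' q' : ℝ → ℝ → ℝ,
        DoubleCusp.IsSolution R' W' q' → DoubleCusp.HasData R' r₀ r₁ →
        DoubleCusp.HasData W' w₀ w₁ → DoubleCusp.HasData q' q₀ q₁ →
        ∀ t, 0 ≤ t → ∀ x, R' t x = R t x ∧ W' t x = W t x ∧ q' t x = q t x := by
  obtain ⟨R, W, q, ⟨h, hR, hW, hq⟩, hpos⟩ :=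
    DoubleCusp.exists_solution hR₀ hr₀ hw₀ hq₀ hr₁ hw₁ hq₁ hm
  exact ⟨R, W, q, ⟨h, hR, hW, hq⟩, hpos, fun R' W' q' h' hR' hW' hq' t ht x =>
    h.unique h' hpos hR hW hq hR' hW' hq' ht x⟩
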